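/- An AW*-algebra is a C*-algebra in which the right annihilator of every subset is of the form $pA$ for a projection $p$ (such an algebra is automatically unital). For projections $e,f$ in an AW*-algebra $A$, write $e\le f$ if $e=ef$; $e\sim f$ if $e=vv^*$ and $f=v^*v$ for some $v\in A$; $e\precsim f$ if $e\sim e'\le f$ for some projection $e'$; and $e\prec f$ if $e\precsim f$ but $e\not\sim f$ (by convention also $0\prec 0$). The central cover $C(e)$ is the least central projection above $e$. A projection $e$ is finite if $e\sim f\le e$ implies $e=f$, and infinite otherwise; a nonzero projection $e$ is properly infinite if for every central projection $z$ the projection $ze$ is either zero or infinite. For a properly infinite projection $e$, let $d(e)$ be the least cardinal that is strictly greater than the cardinality $|I|$ of every orthogonal family $(e_i)_{i\in I}$ of projections with supremum $e$ (in the lattice of projections of $A$) and $e_i\sim e$ for all $i\in I$. A properly infinite projection $e$ is equidimensional if $d(ze)=d(e)$ for every nonzero central projection $z\le C(e)$. **Theorem 5.3.** Let $e$ and $f$ be properly infinite, equidimensional projections in an AW*-algebra. If $C(e)=C(f)$ and $e\prec f$, then $d(e)<d(f)$. -/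

import Mathlib

universe u

namespace AWStar

/-- An AW*-algebra is a C*-algebra in which the right annihilator of every subset `S` is the
right ideal `p A` generated by some projection `p`. Since the annihilator of `{0}` is everything,
such an algebra has a unit, so working with (unital) `CStarAlgebra` loses nothing. -/
class IsAWStarAlgebra (A : Type u) [CStarAlgebra A] : Prop where
  exists_projection_annihilator : ∀ S : Set A, ∃ p : A, IsStarProjection p ∧
    {x : A | ∀ s ∈ S, s * x = 0} = {x : A | ∃ a : A, x = p * a}

section Projections

variable {A : Type u} [CStarAlgebra A]

/-- The order on projections: `e ≤ f` iff `e = e f`. -/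
def ProjLE (e f : A) : Prop := e = e * f

/-- A projection that lies in the centre of the algebra. -/
def IsCentralProjection (z : A) : Prop := IsStarProjection z ∧ z ∈ Set.center A

/-- Murray-von Neumann equivalence `e ∼ f`. -/
def ProjEquiv (e f : A) : Prop := ∃ v : A, e = v * star v ∧ f = star v * v

/-- `e ≾ f`: `e` is equivalent to a subprojection of `f`. -/
def ProjSub (e f : A) : Prop := ∃ e' : A, IsStarProjection e' ∧ ProjEquiv e e' ∧ ProjLE e' f

/-- `e ≺ f`: `e ≾ f` but not `e ∼ f`; by convention also `0 ≺ 0`. -/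
def ProjStrictSub (e f : A) : Prop := (ProjSub e f ∧ ¬ ProjEquiv e f) ∨ (e = 0 ∧ f = 0)

/-- `z` is the least central projection above `e`. -/
def IsCentralCover (e z : A) : Prop :=
  IsCentralProjection z ∧ ProjLE e z ∧ ∀ w : A, IsCentralProjection w → ProjLE e w → ProjLE z w

theorem exists_isCentralCover [IsAWStarAlgebra A] (e : A) : ∃ z : A, IsCentralCover e z := by
  obtain ⟨p, hp, hS⟩ :=
    IsAWStarAlgebra.exists_projection_annihilator {x : A | ∃ a : A, x = e * a}
  have mem : ∀ x : A, (∀ a : A, e * a * x = 0) ↔ p * x = x := by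
    intro x
    have h := Set.ext_iff.mp hS x
    simp only [Set.mem_ofPred_eq] at h
    constructor
    · intro hx
      obtain ⟨b, rfl⟩ := h.mp (by rintro _ ⟨a, rfl⟩; exact hx a)
      rw [← mul_assoc, hp.isIdempotentElem.eq]
    · intro hx a
      exact h.mpr ⟨x, hx.symm⟩ _ ⟨a, rfl⟩
  have hpp : ∀ a : A, e * a * p = 0 := (mem p).mpr hp.isIdempotentElem.eq
  -- the annihilator is a two-sided ideal, so `p a p = a p` for all `a`
  have hpap : ∀ a : A, p * (a * p) = a * p := fun a =>
    (mem _).mp fun b => by rw [← mul_assoc, mul_assoc e b a]; exact hpp _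
  have hcomm : ∀ a : A, p * a = a * p := by
    intro a
    have h1 := congrArg star (hpap (star a))
    simp only [star_mul, star_star, hp.isSelfAdjoint.star_eq] at h1
    rw [← h1, mul_assoc, hpap]
  refine ⟨1 - p, ⟨hp.one_sub, ?_⟩, ?_, ?_⟩
  · rw [Semigroup.mem_center_iff]
    intro a
    rw [mul_sub, sub_mul, hcomm a, mul_one, one_mul]
  · have := hpp 1
    rw [mul_one] at this
    unfold ProjLE
    rw [mul_sub, this, mul_one, sub_zero]
  · rintro w ⟨-, hwc⟩ hew
    have hwc' := Semigroup.mem_center_iff.mp hwc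
    have h1 : p * (1 - w) = 1 - w := (mem _).mp fun a => by
      have : e * a * w = e * a := by rw [mul_assoc, hwc' a, ← mul_assoc, ← hew]
      rw [mul_sub, this, mul_one, sub_self]
    have h2 : (1 - p) * (1 - w) = 0 := by rw [sub_mul, one_mul, h1, sub_self]
    unfold ProjLE
    rw [mul_sub, mul_one, sub_eq_zero] at h2
    exact h2

/-- The central cover of `e`: the least central projection above `e`. -/
noncomputable def centralCover [IsAWStarAlgebra A] (e : A) : A :=
  Classical.choose (exists_isCentralCover e)

theorem isCentralCover_centralCover [IsAWStarAlgebra A] (e : A) :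
    IsCentralCover e (centralCover e) :=
  Classical.choose_spec (exists_isCentralCover e)

/-- A projection `e` is finite when `e ∼ f ≤ e` implies `e = f`. -/
def IsFiniteProj (e : A) : Prop :=
  ∀ f : A, IsStarProjection f → ProjEquiv e f → ProjLE f e → e = f

/-- A nonzero projection `e` is properly infinite when `z e` is zero or infinite for every
central projection `z`. -/
def IsProperlyInfinite (e : A) : Prop :=
  IsStarProjection e ∧ e ≠ 0 ∧
    ∀ z : A, IsCentralProjection z → z * e = 0 ∨ ¬ IsFiniteProj (z * e)

/-- `p = ∑ e i`: `e` is an orthogonal family of projections and `p` is its supremum in the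
partially ordered set of projections. -/
def IsOrthogonalSum {ι : Type u} (e : ι → A) (p : A) : Prop :=
  (∀ i, IsStarProjection (e i)) ∧ (∀ i j, i ≠ j → e i * e j = 0) ∧
    IsStarProjection p ∧ (∀ i, ProjLE (e i) p) ∧
    ∀ q : A, IsStarProjection q → (∀ i, ProjLE (e i) q) → ProjLE p q

/-- The cardinalities of the orthogonal families of projections with sum `e` all of whose members
are equivalent to `e`. For `e ≠ 0` the members of such a family are distinct, so index types in
the universe of `A` suffice. -/
def decompositionCardinals (e : A) : Set Cardinal.{u} :=
  {κ | ∃ (ι : Type u) (p : ι → A),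
    IsOrthogonalSum p e ∧ (∀ i, ProjEquiv (p i) e) ∧ κ = Cardinal.mk ι}

/-- The dimension `d(e)`: the least cardinal strictly greater than the cardinality of every
orthogonal decomposition of `e` into projections equivalent to `e`; `d(0) = 0` by convention. -/
noncomputable def dim (e : A) : Cardinal.{u} :=
  open Classical in
  if e = 0 then 0 else sInf {κ : Cardinal.{u} | ∀ α ∈ decompositionCardinals e, α < κ}

/-- A properly infinite projection `e` is equidimensional when `d(z e) = d(e)` for every nonzero
central projection `z` below the central cover of `e`; by convention, so is `0`. -/
def IsEquidimensional [IsAWStarAlgebra A] (e : A) : Prop :=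
  e = 0 ∨ (IsProperlyInfinite e ∧
    ∀ z : A, IsCentralProjection z → z ≠ 0 → ProjLE z (centralCover e) → dim (z * e) = dim e)

end Projections

end AWStar

namespace AWStar

/-! ### Algebra of projections: order, equivalence, subequivalence, central cut-downs. -/

section Algebra

variable {A : Type u} [CStarAlgebra A]

/-! The claim is proved contrapositively: if e ≾ f and d(f) ≤ d(e), then e ∼ f. Work over a nonzero
central summand. By generalized comparability (`exists_central_comparison`), after a further central
cut a maximal orthogonal family of copies of e inside f leaves a remainder dominated by e
(`exists_isCopyDecomposition`). Let ι index the copies. If |ι| < d(e), then e splits into at least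
|ι| copies of itself, which makes room for all of f inside e
(`IsCopyDecomposition.projSub_of_lt_dim`), and Schröder–Bernstein (`ProjSub.antisymm`) gives e ∼ f
there. If |ι| ≥ d(e), then ι is infinite and f contains |ι| orthogonal copies of itself
(`IsCopyDecomposition.exists_copies`), whence |ι| < d(f) ≤ d(e) ≤ |ι|, absurd. Equidimensionality
identifies the dimensions of the cut-downs with d(e) and d(f), and C(e) = C(f) makes the cut-downs
vanish together.

Thus e ∼ f on every member of a central partition (`exists_central_partition`). Gluing requires
infinite additivity of ∼, which is established here only for mutually orthogonal families
(`IsJoin.projEquiv`). Proper infiniteness supplies the orthogonality: f contains two orthogonal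
copies of itself (`IsProperlyInfinite.exists_halving`), so e can be moved under one of them and
compared piece by piece with the other. -/

theorem ProjLE.mul_eq {e f : A} (h : ProjLE e f) : e * f = e := h.symm

theorem ProjLE.mul_eq' {e f : A} (h : ProjLE e f) (he : IsStarProjection e)
    (hf : IsStarProjection f) : f * e = e := by
  have := congrArg star h.mul_eq
  rwa [star_mul, he.isSelfAdjoint.star_eq, hf.isSelfAdjoint.star_eq] at this

theorem ProjLE.refl {e : A} (he : IsStarProjection e) : ProjLE e e :=
  he.isIdempotentElem.eq.symm

theorem ProjLE.trans {e f g : A} (h : ProjLE e f) (h' : ProjLE f g) : ProjLE e g := by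
  unfold ProjLE
  rw [← h.mul_eq, mul_assoc, h'.mul_eq]

theorem ProjLE.antisymm {e f : A} (h : ProjLE e f) (h' : ProjLE f e) (he : IsStarProjection e)
    (hf : IsStarProjection f) : e = f := by
  rw [← h.mul_eq, h'.mul_eq' hf he]

theorem IsStarProjection.orthogonal_symm {e f : A} (he : IsStarProjection e)
    (hf : IsStarProjection f) (h : e * f = 0) : f * e = 0 := by
  have := congrArg star h
  rwa [star_mul, he.isSelfAdjoint.star_eq, hf.isSelfAdjoint.star_eq, star_zero] at this

theorem mul_eq_zero_of_projLE {e f e' f' : A}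
    (h : ProjLE e' e) (hf : IsStarProjection f) (hf' : IsStarProjection f') (k : ProjLE f' f)
    (hef : e * f = 0) : e' * f' = 0 := by
  rw [← h.mul_eq, ← k.mul_eq' hf' hf, mul_assoc, ← mul_assoc e, hef, zero_mul, mul_zero]

theorem isStarProjection_iff_mul_star {p : A} :
    IsStarProjection p ↔ p * p = p ∧ star p = p :=
  ⟨fun h => ⟨h.isIdempotentElem.eq, h.isSelfAdjoint.star_eq⟩, fun h => ⟨h.1, h.2⟩⟩

theorem isStarProjection_add {e f : A} (he : IsStarProjection e) (hf : IsStarProjection f)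
    (h : e * f = 0) : IsStarProjection (e + f) := by
  rw [isStarProjection_iff_mul_star]
  constructor
  · rw [add_mul, mul_add, mul_add, h, IsStarProjection.orthogonal_symm he hf h,
      he.isIdempotentElem.eq, hf.isIdempotentElem.eq, add_zero, zero_add]
  · rw [star_add, he.isSelfAdjoint.star_eq, hf.isSelfAdjoint.star_eq]

theorem isStarProjection_sub {e f : A} (he : IsStarProjection e) (hf : IsStarProjection f)
    (h : ProjLE e f) : IsStarProjection (f - e) := by
  rw [isStarProjection_iff_mul_star]
  constructor
  · rw [sub_mul, mul_sub, mul_sub, h.mul_eq, h.mul_eq' he hf,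
      he.isIdempotentElem.eq, hf.isIdempotentElem.eq, sub_self, sub_zero]
  · rw [star_sub, he.isSelfAdjoint.star_eq, hf.isSelfAdjoint.star_eq]

theorem sub_projLE {e f : A} (hf : IsStarProjection f)
    (h : ProjLE e f) : ProjLE (f - e) f := by
  unfold ProjLE
  rw [sub_mul, hf.isIdempotentElem.eq, h.mul_eq]

theorem mul_sub_eq_zero_of_projLE {e f : A} (he : IsStarProjection e) (h : ProjLE e f) :
    e * (f - e) = 0 := by
  rw [mul_sub, h.mul_eq, he.isIdempotentElem.eq, sub_self]

theorem sub_mul_eq_zero_of_projLE {e f : A} (he : IsStarProjection e) (hf : IsStarProjection f)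
    (h : ProjLE e f) : (f - e) * e = 0 := by
  rw [sub_mul, h.mul_eq' he hf, he.isIdempotentElem.eq, sub_self]

theorem projLE_add_left {e f : A} (he : IsStarProjection e) (h : e * f = 0) :
    ProjLE e (e + f) := by
  unfold ProjLE
  rw [mul_add, h, he.isIdempotentElem.eq, add_zero]

theorem projLE_add_right {e f : A} (hf : IsStarProjection f) (h : f * e = 0) :
    ProjLE f (e + f) := by
  rw [add_comm]; exact projLE_add_left hf h

theorem ProjLE.add {e f g : A} (he : ProjLE e g) (hf : ProjLE f g) : ProjLE (e + f) g := by
  unfold ProjLE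
  rw [add_mul, he.mul_eq, hf.mul_eq]

theorem ProjLE.le_sub {x e f : A} (h : ProjLE x f) (h0 : x * e = 0) : ProjLE x (f - e) := by
  unfold ProjLE
  rw [mul_sub, h.mul_eq, h0, sub_zero]

/-- By the C*-identity it suffices that `v * star v * v - v` times its adjoint vanishes, and this
expands into powers of the projection `v * star v`. -/
theorem mul_star_mul_self {v : A} (h : IsStarProjection (v * star v)) : v * star v * v = v := by
  have h1 := h.isIdempotentElem.eq
  rw [← sub_eq_zero, ← CStarRing.mul_star_self_eq_zero_iff]
  simp only [star_sub, star_mul, star_star, sub_mul, mul_sub]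
  have h2 : v * star v * v * (star v * (v * star v)) = v * star v := by
    calc _ = (v * star v) * (v * star v) * (v * star v) := by simp only [mul_assoc]
      _ = _ := by rw [h1, h1]
  have h3 : v * star v * v * star v = v * star v := by rw [mul_assoc, h1]
  have h4 : v * (star v * (v * star v)) = v * star v := by rw [← mul_assoc, h1]
  rw [h2, h3, h4]; simp

theorem isStarProjection_star_mul {v : A} (h : IsStarProjection (v * star v)) :
    IsStarProjection (star v * v) := by
  rw [isStarProjection_iff_mul_star]
  constructor
  · rw [mul_assoc, ← mul_assoc v, mul_star_mul_self h]
  · simp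

/-- A partial isometry realising an equivalence, with the identities used in computations. -/
theorem ProjEquiv.exists_partialIsometry {e f : A} (h : ProjEquiv e f) (he : IsStarProjection e) :
    ∃ v : A, v * star v = e ∧ star v * v = f ∧ e * v = v ∧ v * f = v ∧ f * star v = star v ∧
      star v * e = star v := by
  obtain ⟨v, rfl, rfl⟩ := h
  have h1 := mul_star_mul_self he
  have h2 := congrArg star h1
  simp only [star_mul, star_star] at h2
  exact ⟨v, rfl, rfl, h1, by rw [← mul_assoc, h1], by rw [mul_assoc, h2], h2⟩

theorem ProjEquiv.isStarProjection {e f : A} (h : ProjEquiv e f) (he : IsStarProjection e) :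
    IsStarProjection f := by
  obtain ⟨v, rfl, rfl⟩ := h
  exact isStarProjection_star_mul he

theorem ProjEquiv.refl {e : A} (he : IsStarProjection e) : ProjEquiv e e :=
  ⟨e, by rw [he.isSelfAdjoint.star_eq, he.isIdempotentElem.eq],
    by rw [he.isSelfAdjoint.star_eq, he.isIdempotentElem.eq]⟩

theorem ProjEquiv.symm {e f : A} (h : ProjEquiv e f) : ProjEquiv f e := by
  obtain ⟨v, h1, h2⟩ := h
  exact ⟨star v, by rw [star_star, h2], by rw [star_star, h1]⟩

theorem ProjEquiv.trans {e f g : A} (h : ProjEquiv e f) (h' : ProjEquiv f g)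
    (he : IsStarProjection e) : ProjEquiv e g := by
  obtain ⟨v, h1, h2, h3, h4, -, -⟩ := h.exists_partialIsometry he
  obtain ⟨w, k1, k2, k3, k4, -, -⟩ := h'.exists_partialIsometry (h.isStarProjection he)
  refine ⟨v * w, ?_, ?_⟩
  · rw [star_mul, mul_assoc, ← mul_assoc w, k1, ← mul_assoc, h4, h1]
  · rw [star_mul, mul_assoc, ← mul_assoc (star v), h2, k3, k2]

theorem ProjEquiv.eq_zero {e : A} (h : ProjEquiv e 0) : e = 0 := by
  obtain ⟨v, h1, h2⟩ := h
  rw [eq_comm, CStarRing.star_mul_self_eq_zero_iff] at h2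
  rw [h1, h2, zero_mul]

/-- Compression of a subprojection along a partial isometry. -/
theorem isStarProjection_conj {v x : A}
    (hx : IsStarProjection x) (h : ProjLE x (v * star v)) : IsStarProjection (star v * x * v) := by
  rw [isStarProjection_iff_mul_star]
  constructor
  · calc star v * x * v * (star v * x * v) = star v * (x * (v * star v)) * x * v := by
          simp only [mul_assoc]
      _ = _ := by rw [h.mul_eq, mul_assoc (star v), hx.isIdempotentElem.eq]
  · simp only [star_mul, star_star, hx.isSelfAdjoint.star_eq, mul_assoc]

theorem projEquiv_conj {v x : A} (hx : IsStarProjection x) (h : ProjLE x (v * star v)) :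
    ProjEquiv x (star v * x * v) := by
  refine ⟨x * v, ?_, ?_⟩
  · rw [star_mul, hx.isSelfAdjoint.star_eq, mul_assoc, ← mul_assoc v, ← mul_assoc, h.mul_eq,
      hx.isIdempotentElem.eq]
  · rw [star_mul, hx.isSelfAdjoint.star_eq, mul_assoc (star v) x (x * v), ← mul_assoc x x,
      hx.isIdempotentElem.eq, mul_assoc]

theorem conj_mul_conj {v x y : A} (h : ProjLE x (v * star v)) :
    star v * x * v * (star v * y * v) = star v * (x * y) * v := by
  calc star v * x * v * (star v * y * v) = star v * (x * (v * star v)) * y * v := by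
        simp only [mul_assoc]
    _ = _ := by rw [h.mul_eq]; simp only [mul_assoc]

theorem conj_mono {v x y : A} (h : ProjLE x (v * star v)) (hxy : ProjLE x y) :
    ProjLE (star v * x * v) (star v * y * v) := by
  unfold ProjLE
  rw [conj_mul_conj h, hxy.mul_eq]

theorem conj_projLE {v x : A} (hv : IsStarProjection (v * star v)) :
    ProjLE (star v * x * v) (star v * v) := by
  unfold ProjLE
  rw [mul_assoc _ v, ← mul_assoc v, mul_star_mul_self hv]

/-- Finite additivity of equivalence. -/
theorem ProjEquiv.add {a b c d : A} (ha : IsStarProjection a) (hb : IsStarProjection b)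
    (hab : a * b = 0) (hcd : c * d = 0) (h : ProjEquiv a c) (k : ProjEquiv b d) :
    ProjEquiv (a + b) (c + d) := by
  have hc := h.isStarProjection ha
  have hd := k.isStarProjection hb
  obtain ⟨v, h1, h2, h3, h4, h5, h6⟩ := h.exists_partialIsometry ha
  obtain ⟨w, k1, k2, k3, k4, k5, k6⟩ := k.exists_partialIsometry hb
  have hdc := IsStarProjection.orthogonal_symm hc hd hcd
  have hba := IsStarProjection.orthogonal_symm ha hb hab
  have e1 : v * star w = 0 := by rw [← h4, ← k5, mul_assoc, ← mul_assoc c, hcd]; simp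
  have e2 : w * star v = 0 := by rw [← k4, ← h5, mul_assoc, ← mul_assoc d, hdc]; simp
  have e3 : star v * w = 0 := by rw [← h6, ← k3, mul_assoc, ← mul_assoc a, hab]; simp
  have e4 : star w * v = 0 := by rw [← k6, ← h3, mul_assoc, ← mul_assoc b, hba]; simp
  refine ⟨v + w, ?_, ?_⟩
  · rw [star_add, add_mul, mul_add, mul_add, e1, e2, h1, k1, add_zero, zero_add]
  · rw [star_add, add_mul, mul_add, mul_add, e3, e4, h2, k2, add_zero, zero_add]

theorem ProjLE.projSub {e f : A} (h : ProjLE e f) (he : IsStarProjection e) : ProjSub e f :=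
  ⟨e, he, ProjEquiv.refl he, h⟩

theorem ProjEquiv.projSub {e f : A} (h : ProjEquiv e f) (he : IsStarProjection e) :
    ProjSub e f :=
  ⟨f, h.isStarProjection he, h, ProjLE.refl (h.isStarProjection he)⟩

theorem ProjEquiv.exists_projLE {e f x : A} (h : ProjEquiv e f) (he : IsStarProjection e)
    (hx : IsStarProjection x) (hxe : ProjLE x e) :
    ∃ y, IsStarProjection y ∧ ProjEquiv x y ∧ ProjLE y f := by
  obtain ⟨v, rfl, rfl⟩ := h
  exact ⟨star v * x * v, isStarProjection_conj hx hxe, projEquiv_conj hx hxe, conj_projLE he⟩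

theorem ProjSub.trans {e f g : A} (h : ProjSub e f) (k : ProjSub f g) (he : IsStarProjection e)
    (hf : IsStarProjection f) : ProjSub e g := by
  obtain ⟨e', he', h1, h2⟩ := h
  obtain ⟨f', hf', k1, k2⟩ := k
  obtain ⟨y, hy, y1, y2⟩ := k1.exists_projLE hf he' h2
  exact ⟨y, hy, h1.trans y1 he, y2.trans k2⟩

theorem ProjSub.add {a b c d : A} (ha : IsStarProjection a) (hb : IsStarProjection b)
    (hc : IsStarProjection c) (hd : IsStarProjection d)
    (hab : a * b = 0) (hcd : c * d = 0) (h : ProjSub a c) (k : ProjSub b d) :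
    ProjSub (a + b) (c + d) := by
  obtain ⟨c', hc', h1, h2⟩ := h
  obtain ⟨d', hd', k1, k2⟩ := k
  have hcd' := mul_eq_zero_of_projLE h2 hd hd' k2 hcd
  exact ⟨c' + d', isStarProjection_add hc' hd' hcd', ProjEquiv.add ha hb hab hcd' h1 k1,
    (h2.trans (projLE_add_left hc hcd)).add
      (k2.trans (projLE_add_right hd (IsStarProjection.orthogonal_symm hc hd hcd)))⟩

theorem IsCentralProjection.comm {z : A} (hz : IsCentralProjection z) (a : A) : a * z = z * a :=
  Semigroup.mem_center_iff.mp hz.2 a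

theorem IsCentralProjection.isStarProjection_mul {z e : A} (hz : IsCentralProjection z)
    (he : IsStarProjection e) : IsStarProjection (z * e) := by
  rw [isStarProjection_iff_mul_star]
  constructor
  · rw [mul_assoc, ← mul_assoc e, hz.comm e, mul_assoc z e, he.isIdempotentElem.eq, ← mul_assoc,
      hz.1.isIdempotentElem.eq]
  · rw [star_mul, he.isSelfAdjoint.star_eq, hz.1.isSelfAdjoint.star_eq, hz.comm]

theorem IsCentralProjection.mul {z w : A} (hz : IsCentralProjection z)
    (hw : IsCentralProjection w) : IsCentralProjection (z * w) :=
  ⟨hz.isStarProjection_mul hw.1, Set.mul_mem_center hz.2 hw.2⟩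

theorem IsCentralProjection.one_sub {z : A} (hz : IsCentralProjection z) :
    IsCentralProjection (1 - z) := by
  refine ⟨hz.1.one_sub, ?_⟩
  rw [Semigroup.mem_center_iff]
  intro a
  rw [mul_sub, sub_mul, hz.comm a, mul_one, one_mul]

theorem IsCentralProjection.mul_mul_mul {z : A} (hz : IsCentralProjection z) (a b : A) :
    z * a * (z * b) = z * (a * b) := by
  rw [mul_assoc, ← mul_assoc a, hz.comm a, mul_assoc z a, ← mul_assoc z z,
    hz.1.isIdempotentElem.eq]

theorem mul_projLE_right (z : A) {e : A}
    (he : IsStarProjection e) : ProjLE (z * e) e := by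
  unfold ProjLE
  rw [mul_assoc, he.isIdempotentElem.eq]

theorem ProjLE.central_mul {e f z : A} (h : ProjLE e f) (hz : IsCentralProjection z) :
    ProjLE (z * e) (z * f) := by
  unfold ProjLE
  rw [hz.mul_mul_mul, h.mul_eq]

theorem ProjEquiv.central_mul {e f z : A} (h : ProjEquiv e f) (hz : IsCentralProjection z) :
    ProjEquiv (z * e) (z * f) := by
  obtain ⟨v, rfl, rfl⟩ := h
  refine ⟨z * v, ?_, ?_⟩
  · rw [star_mul, hz.1.isSelfAdjoint.star_eq, hz.comm, hz.mul_mul_mul]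
  · rw [star_mul, hz.1.isSelfAdjoint.star_eq, hz.comm, hz.mul_mul_mul]

theorem ProjSub.central_mul {e f z : A} (h : ProjSub e f) (hz : IsCentralProjection z) :
    ProjSub (z * e) (z * f) := by
  obtain ⟨e', he', h1, h2⟩ := h
  exact ⟨z * e', hz.isStarProjection_mul he', h1.central_mul hz, h2.central_mul hz⟩

/-- The hypothesis says that `A p` is stable under left multiplication by `p`; taking adjoints gives
`p a = p a p` as well. -/
theorem isCentralProjection_of_mul_mul {p : A} (hp : IsStarProjection p)
    (h : ∀ a : A, p * (a * p) = a * p) : IsCentralProjection p := by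
  refine ⟨hp, Semigroup.mem_center_iff.mpr fun a => ?_⟩
  have h1 := congrArg star (h (star a))
  simp only [star_mul, star_star, hp.isSelfAdjoint.star_eq] at h1
  rw [← h1, mul_assoc, h]

/-- A projection that embeds in a proper subprojection contains a sequence of orthogonal copies of
every subprojection of the complement. -/
theorem exists_orthogonal_sequence {g g' s : A} (hg : IsStarProjection g)
    (h : ProjEquiv g g') (hle : ProjLE g' g) (hs : IsStarProjection s) (hsg : ProjLE s g)
    (hsg' : s * g' = 0) :
    ∃ p : ℕ → A, (∀ n, IsStarProjection (p n)) ∧ (∀ n, ProjLE (p n) g) ∧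
      (∀ n, ProjEquiv (p n) s) ∧ ∀ m n, m ≠ n → p m * p n = 0 := by
  obtain ⟨v, h1, h2⟩ := h
  have hv : IsStarProjection (v * star v) := h1 ▸ hg
  have hg' : IsStarProjection g' := h2 ▸ isStarProjection_star_mul hv
  -- Iterate the shift `x ↦ star v * x * v`, which maps subprojections of `g` below `g'`. The first
  -- term `s` misses `g'`, hence is orthogonal to all later terms, and the shift propagates this.
  let p : ℕ → A := fun n => Nat.rec s (fun _ x => star v * x * v) n
  have hp : ∀ n, IsStarProjection (p n) ∧ ProjLE (p n) g ∧ ProjEquiv (p n) s := by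
    intro n
    induction n with
    | zero => exact ⟨hs, hsg, ProjEquiv.refl hs⟩
    | succ n ih =>
      obtain ⟨i1, i2, i3⟩ := ih
      have i2' : ProjLE (p n) (v * star v) := h1 ▸ i2
      refine ⟨isStarProjection_conj i1 i2', ?_, ?_⟩
      · refine ProjLE.trans ?_ hle
        rw [h2]
        exact conj_projLE hv
      · exact (projEquiv_conj i1 i2').symm.trans i3 (isStarProjection_conj i1 i2')
  have hlt : ∀ m n, m < n → p m * p n = 0 := by
    intro m
    induction m with
    | zero =>
      intro n hn
      obtain ⟨k, rfl⟩ := Nat.exists_eq_succ_of_ne_zero hn.ne'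
      have : ProjLE (p (k + 1)) g' := by
        rw [h2]; exact conj_projLE hv
      exact mul_eq_zero_of_projLE (ProjLE.refl hs) hg' (hp (k + 1)).1 this hsg'
    | succ m ih =>
      intro n hn
      obtain ⟨k, rfl⟩ := Nat.exists_eq_succ_of_ne_zero (Nat.ne_zero_of_lt hn)
      have := ih k (by omega)
      change star v * p m * v * (star v * p k * v) = 0
      rw [conj_mul_conj (h1 ▸ (hp m).2.1), this]; simp
  refine ⟨p, fun n => (hp n).1, fun n => (hp n).2.1, fun n => (hp n).2.2, fun m n hmn => ?_⟩
  rcases lt_or_gt_of_ne hmn with h | h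
  · exact hlt m n h
  · exact IsStarProjection.orthogonal_symm (hp n).1 (hp m).1 (hlt n m h)

end Algebra

/-! ### Suprema as annihilators, additivity of equivalence, Schröder–Bernstein. -/

section Joins

variable {A : Type u} [CStarAlgebra A] {ι κ : Type*}

/-- `s` is the projection with the same right annihilator as the family `p`. For a family of
projections in an AW*-algebra this is the supremum. -/
def IsJoin (p : ι → A) (s : A) : Prop :=
  IsStarProjection s ∧ ∀ x : A, s * x = 0 ↔ ∀ i, p i * x = 0

/-- If `q A` is the right annihilator of the family, `1 - q` has the same annihilator. The members
need not be projections, which is used for supports of arbitrary elements. -/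
theorem exists_isJoin [IsAWStarAlgebra A] (p : ι → A) : ∃ s : A, IsJoin p s := by
  obtain ⟨q, hq, hS⟩ := IsAWStarAlgebra.exists_projection_annihilator (Set.range p)
  refine ⟨1 - q, hq.one_sub, fun x => ?_⟩
  have h := Set.ext_iff.mp hS x
  simp only [Set.mem_ofPred_eq, Set.forall_mem_range] at h
  rw [h, sub_mul, one_mul, sub_eq_zero]
  constructor
  · intro hx
    exact ⟨x, hx⟩
  · rintro ⟨a, rfl⟩
    rw [← mul_assoc, hq.isIdempotentElem.eq]

namespace IsJoin

variable {p : ι → A} {s : A}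

theorem projLE (h : IsJoin p s) (i : ι) : ProjLE (p i) s := by
  have := (h.2 (1 - s)).mp (by rw [mul_sub, h.1.isIdempotentElem.eq, mul_one, sub_self]) i
  rw [mul_sub, mul_one, sub_eq_zero] at this
  exact this

theorem projLE_of_forall (h : IsJoin p s) {q : A} (hq : ∀ i, ProjLE (p i) q) : ProjLE s q := by
  have := (h.2 (1 - q)).mpr fun i => by rw [mul_sub, mul_one, (hq i).mul_eq, sub_self]
  rw [mul_sub, mul_one, sub_eq_zero] at this
  exact this

theorem mul_eq_zero (h : IsJoin p s) {x : A} (hx : ∀ i, p i * x = 0) : s * x = 0 :=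
  (h.2 x).mpr hx

theorem mul_eq_zero' (h : IsJoin p s) (hp : ∀ i, IsStarProjection (p i)) {x : A}
    (hx : ∀ i, x * p i = 0) : x * s = 0 := by
  have := h.mul_eq_zero (x := star x) fun i => by
    rw [← (hp i).isSelfAdjoint.star_eq, ← star_mul, hx, star_zero]
  have := congrArg star this
  rwa [star_mul, star_star, h.1.isSelfAdjoint.star_eq, star_zero] at this

theorem eq_of_annihilator {s t : A} (hs : IsStarProjection s) (ht : IsStarProjection t)
    (h : ∀ x : A, s * x = 0 ↔ t * x = 0) : s = t := by
  have h1 := (h (1 - t)).mpr (by rw [mul_sub, ht.isIdempotentElem.eq, mul_one, sub_self])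
  have h2 := (h (1 - s)).mp (by rw [mul_sub, hs.isIdempotentElem.eq, mul_one, sub_self])
  rw [mul_sub, mul_one, sub_eq_zero] at h1 h2
  exact ProjLE.antisymm h1 h2 hs ht

theorem eq {t : A} (h : IsJoin p s) (k : IsJoin p t) : s = t :=
  eq_of_annihilator h.1 k.1 fun x => (h.2 x).trans (k.2 x).symm

theorem central_mul (h : IsJoin p s) {z : A} (hz : IsCentralProjection z) :
    IsJoin (fun i => z * p i) (z * s) := by
  refine ⟨hz.isStarProjection_mul h.1, fun x => ?_⟩
  rw [← hz.comm, mul_assoc, h.2]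
  simp only [← hz.comm, mul_assoc]

/-- The join of a family together with an orthogonal projection. -/
theorem option {r : A} (hr : IsStarProjection r) (h : IsJoin p s) (hrs : r * s = 0) :
    IsJoin (fun o : Option ι => o.elim r p) (r + s) := by
  have hsr := IsStarProjection.orthogonal_symm hr h.1 hrs
  refine ⟨isStarProjection_add hr h.1 hrs, fun x => ?_⟩
  rw [Option.forall]
  simp only [Option.elim_none, Option.elim_some, ← h.2]
  constructor
  · intro hx
    have h1 := congrArg (r * ·) hx
    have h2 := congrArg (s * ·) hx
    simp only [← mul_assoc, mul_add, hrs, hsr, hr.isIdempotentElem.eq, h.1.isIdempotentElem.eq,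
      add_zero, zero_add, mul_zero] at h1 h2
    exact ⟨h1, h2⟩
  · rintro ⟨h1, h2⟩
    rw [add_mul, h1, h2, add_zero]

/-- A join splits along a partition of the index set. -/
theorem eq_add_compl (h : IsJoin p s) (hp : ∀ i, IsStarProjection (p i))
    (ho : ∀ i j, i ≠ j → p i * p j = 0) {t : κ → ι} {a b : A}
    (ha : IsJoin (p ∘ t) a) (hb : IsJoin (fun i : ((Set.range t)ᶜ : Set ι) => p i) b) :
    b * a = 0 ∧ s = b + a := by
  have hba : b * a = 0 := hb.mul_eq_zero fun i => ha.mul_eq_zero' (fun j => hp _) fun j =>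
    ho _ _ fun hij => i.2 ⟨j, hij.symm⟩
  refine ⟨hba, eq_of_annihilator h.1 (isStarProjection_add hb.1 ha.1 hba) fun x => ?_⟩
  rw [(option hb.1 ha hba).2, h.2, Option.forall]
  simp only [Option.elim_none, Option.elim_some, hb.2]
  constructor
  · intro hx
    exact ⟨fun i => hx _, fun i => hx _⟩
  · rintro ⟨h1, h2⟩ i
    by_cases hi : i ∈ Set.range t
    · obtain ⟨k, rfl⟩ := hi
      exact h2 k
    · exact h1 ⟨i, hi⟩

/-- Complete additivity of equivalence for mutually orthogonal families. -/
theorem projEquiv [IsAWStarAlgebra A] {q : ι → A} {e f : A} (he : IsJoin p e) (hf : IsJoin q f)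
    (hp : ∀ i, IsStarProjection (p i)) (hpo : ∀ i j, i ≠ j → p i * p j = 0)
    (hqo : ∀ i j, i ≠ j → q i * q j = 0) (hpq : ∀ i j, p i * q j = 0)
    (h : ∀ i, ProjEquiv (p i) (q i)) : ProjEquiv e f := by
  have hq : ∀ i, IsStarProjection (q i) := fun i => (h i).isStarProjection (hp i)
  choose w w1 w2 w3 w4 w5 w6 using fun i => (h i).exists_partialIsometry (hp i)
  have hqp : ∀ i j, q i * p j = 0 := fun i j =>
    IsStarProjection.orthogonal_symm (hp _) (hq _) (hpq j i)
  have pp := fun i => (hp i).isIdempotentElem.eq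
  have qq := fun i => (hq i).isIdempotentElem.eq
  have ps := fun i => (hp i).isSelfAdjoint.star_eq
  have qs := fun i => (hq i).isSelfAdjoint.star_eq
  -- `g i` is twice a projection that intertwines `p i` and `q i`
  set g : ι → A := fun i => p i + q i + w i + star (w i) with hg
  have pg : ∀ i, p i * g i = p i + w i := fun i => by
    have : p i * star (w i) = 0 := by rw [← w5, ← mul_assoc, hpq, zero_mul]
    simp only [hg, mul_add, pp, hpq, w3, this, add_zero]
  have gq : ∀ i, g i * q i = q i + w i := fun i => by
    have : star (w i) * q i = 0 := by rw [← w6, mul_assoc, hpq, mul_zero]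
    simp only [hg, add_mul, qq, hpq, w4, this, add_zero, zero_add]
  have gs : ∀ i, star (g i) = g i := fun i => by
    simp only [hg, star_add, ps, qs, star_star]; abel
  have gp : ∀ i, g i * p i = p i + star (w i) := fun i => by
    have := congrArg star (pg i)
    rwa [star_mul, gs, ps, star_add, ps] at this
  have qg : ∀ i, q i * g i = q i + star (w i) := fun i => by
    have := congrArg star (gq i)
    rwa [star_mul, gs, qs, star_add, qs] at this
  have gg : ∀ i, g i * g i = (2 : ℂ) • g i := fun i => by
    have e1 : g i * w i = q i + w i := by rw [← w3, ← mul_assoc, gp, add_mul, w3, w2, add_comm]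
    have e2 : g i * star (w i) = p i + star (w i) := by
      rw [← w5, ← mul_assoc, gq, add_mul, w5, w1, add_comm]
    conv_lhs => rhs; simp only [hg]
    rw [mul_add, mul_add, mul_add, gp, gq, e1, e2]
    simp only [hg]; module
  have po : ∀ i j, i ≠ j → g j * p i = 0 := fun i j hij => by
    have e1 : w j * p i = 0 := by rw [← w4, mul_assoc, hqp, mul_zero]
    have e2 : star (w j) * p i = 0 := by rw [← w6, mul_assoc, hpo _ _ hij.symm, mul_zero]
    simp only [hg, add_mul, e1, e2, hqp, hpo _ _ hij.symm, add_zero]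
  have qo : ∀ i j, i ≠ j → g j * q i = 0 := fun i j hij => by
    have e1 : w j * q i = 0 := by rw [← w4, mul_assoc, hqo _ _ hij.symm, mul_zero]
    have e2 : star (w j) * q i = 0 := by rw [← w6, mul_assoc, hpq, mul_zero]
    simp only [hg, add_mul, e1, e2, hpq, hqo _ _ hij.symm, add_zero]
  have go : ∀ i j, i ≠ j → g j * g i = 0 := fun i j hij => by
    have e1 : g j * w i = 0 := by rw [← w3, ← mul_assoc, po _ _ hij, zero_mul]
    have e2 : g j * star (w i) = 0 := by rw [← w5, ← mul_assoc, qo _ _ hij, zero_mul]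
    conv_lhs => rhs; simp only [hg]
    simp only [mul_add, po _ _ hij, qo _ _ hij, e1, e2, add_zero]
  -- `G` plays the role of the sum of the orthogonal projections `g i / 2`; the factor does not
  -- affect annihilators. Its corner between `e` and `f`, doubled, will be the partial isometry that
  -- sums the `w i`.
  obtain ⟨G, hG⟩ := exists_isJoin g
  have Gs := hG.1.isSelfAdjoint.star_eq
  have Gg : ∀ i, G * g i = g i := fun i => by
    have := (hG.projLE i).mul_eq
    have := congrArg star this
    rwa [star_mul, gs, Gs] at this
  -- No series is available, so the action of `G` is read off from annihilators: every `g j` kills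
  -- `2 x - g i * x`, hence so does `G`.
  have key : ∀ i x, (∀ j, j ≠ i → g j * x = 0) → (2 : ℂ) • (G * x) = g i * x := fun i x hx => by
    have : G * ((2 : ℂ) • x - g i * x) = 0 := hG.mul_eq_zero fun j => by
      by_cases hj : j = i
      · subst hj
        rw [mul_sub, ← mul_assoc, gg]; simp
      · rw [mul_sub, ← mul_assoc, go _ _ (Ne.symm hj), zero_mul, mul_smul_comm, hx j hj]; simp
    rw [mul_sub, ← mul_assoc, Gg, sub_eq_zero, mul_smul_comm] at this
    exact this
  have Gp : ∀ i, (2 : ℂ) • (G * p i) = p i + star (w i) := fun i => by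
    rw [key i _ fun j hj => po _ _ hj.symm, gp]
  have Gq : ∀ i, (2 : ℂ) • (G * q i) = q i + w i := fun i => by
    rw [key i _ fun j hj => qo _ _ hj.symm, gq]
  have pG : ∀ i, (2 : ℂ) • (p i * G) = p i + w i := fun i => by
    have := congrArg star (Gp i)
    simpa only [star_smul, star_mul, Gs, ps, star_add, star_star, star_ofNat] using this
  have pe := fun i => (he.projLE i).mul_eq
  have qf := fun i => (hf.projLE i).mul_eq
  have fq := fun i => (hf.projLE i).mul_eq' (hq i) hf.1
  have ep := fun i => (he.projLE i).mul_eq' (hp i) he.1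
  have pf : ∀ i, p i * f = 0 := fun i => hf.mul_eq_zero' hq (hpq i)
  have eq : ∀ i, e * q i = 0 := fun i => he.mul_eq_zero fun j => hpq j i
  have wf : ∀ i, w i * f = w i := fun i => by rw [← w4, mul_assoc, qf]
  have ew : ∀ i, e * w i = w i := fun i => by rw [← w3, ← mul_assoc, ep]
  set v : A := (2 : ℂ) • (e * G * f) with hv
  have pv : ∀ i, p i * v = w i := fun i => by
    calc p i * v = ((2 : ℂ) • (p i * G)) * f := by
          rw [hv, mul_smul_comm, smul_mul_assoc, ← mul_assoc, ← mul_assoc, pe]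
      _ = w i := by rw [pG, add_mul, pf, wf, zero_add]
  have vq : ∀ i, v * q i = w i := fun i => by
    calc v * q i = e * ((2 : ℂ) • (G * q i)) := by
          rw [hv, mul_smul_comm, smul_mul_assoc, mul_assoc, fq, mul_assoc]
      _ = w i := by rw [Gq, mul_add, eq, ew, zero_add]
  have ev : e * v = v := by
    rw [hv, mul_smul_comm, ← mul_assoc, ← mul_assoc, he.1.isIdempotentElem.eq]
  have vf : v * f = v := by
    rw [hv, smul_mul_assoc, mul_assoc, hf.1.isIdempotentElem.eq]
  have qv : ∀ i, q i * star v = star (w i) := fun i => by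
    rw [← vq, star_mul, qs]
  have fv : f * star v = star v := by
    rw [← hf.1.isSelfAdjoint.star_eq, ← star_mul, vf]
  refine ⟨v, ?_, ?_⟩
  · have : e * (v * star v - e) = 0 := he.mul_eq_zero fun i => by
      rw [mul_sub, pe, ← mul_assoc, pv, ← w4, mul_assoc, qv, w1, sub_self]
    rw [mul_sub, ← mul_assoc, ev, he.1.isIdempotentElem.eq, sub_eq_zero] at this
    exact this.symm
  · have : f * (star v * v - f) = 0 := hf.mul_eq_zero fun i => by
      rw [mul_sub, qf, ← mul_assoc, qv, ← w6, mul_assoc, pv, w2, sub_self]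
    rw [mul_sub, ← mul_assoc, fv, hf.1.isIdempotentElem.eq, sub_eq_zero] at this
    exact this.symm

/-- Complete additivity of subequivalence, along an embedding of the index types. -/
theorem projSub [IsAWStarAlgebra A] {q : κ → A} {e f : A} (he : IsJoin p e) (hf : IsJoin q f)
    (hp : ∀ i, IsStarProjection (p i)) (hq : ∀ i, IsStarProjection (q i))
    (hpo : ∀ i j, i ≠ j → p i * p j = 0)
    (hqo : ∀ i j, i ≠ j → q i * q j = 0) (hpq : ∀ i j, p i * q j = 0) (φ : ι ↪ κ)
    (h : ∀ i, ProjSub (p i) (q (φ i))) : ProjSub e f := by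
  choose q' h1 h2 h3 using h
  obtain ⟨f', hf'⟩ := exists_isJoin q'
  refine ⟨f', hf'.1, projEquiv he hf' hp hpo (fun i j hij => ?_) (fun i j => ?_) h2,
    hf'.projLE_of_forall fun i => (h3 i).trans (hf.projLE _)⟩
  · exact mul_eq_zero_of_projLE (h3 i) (hq _) (h1 _) (h3 j) (hqo _ _ (φ.injective.ne hij))
  · exact mul_eq_zero_of_projLE (ProjLE.refl (hp i)) (hq _) (h1 _) (h3 j) (hpq i (φ j))

theorem isOrthogonalSum {ι : Type u} {p : ι → A} {s : A} (h : IsJoin p s)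
    (hp : ∀ i, IsStarProjection (p i)) (ho : ∀ i j, i ≠ j → p i * p j = 0) :
    IsOrthogonalSum p s :=
  ⟨hp, ho, h.1, h.projLE, fun _ _ hq => h.projLE_of_forall hq⟩

end IsJoin

/-- This links the order-theoretic suprema in the definition of `dim` to the annihilator
description: the annihilator join is also a least upper bound. -/
theorem IsOrthogonalSum.isJoin [IsAWStarAlgebra A] {ι : Type u} {p : ι → A} {s : A}
    (h : IsOrthogonalSum p s) : IsJoin p s := by
  obtain ⟨t, ht⟩ := exists_isJoin p
  obtain ⟨-, -, h3, h4, h5⟩ := h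
  rwa [ProjLE.antisymm (h5 t ht.1 ht.projLE) (ht.projLE_of_forall h4) h3 ht.1]

/-- The Schröder–Bernstein theorem for projections. -/
theorem ProjSub.antisymm [IsAWStarAlgebra A] {e f : A} (he : IsStarProjection e)
    (hf : IsStarProjection f) (h : ProjSub e f) (k : ProjSub f e) : ProjEquiv e f := by
  obtain ⟨f', hf', ⟨v, hv1, hv2⟩, hle⟩ := h
  obtain ⟨e', he', ⟨w, hw1, hw2⟩, kle⟩ := k
  -- `y x` is the complement in `f` of the copy of `x`; `φ` is monotone on subprojections of `e`
  set y : A → A := fun x => f - star v * x * v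
  set φ : A → A := fun x => e - star w * y x * w
  have hwp : IsStarProjection (w * star w) := hw1 ▸ hf
  have hvp : IsStarProjection (v * star v) := hv1 ▸ he
  have hv : ∀ x, IsStarProjection x → ProjLE x e →
      IsStarProjection (star v * x * v) ∧ ProjLE (star v * x * v) f := fun x hx hxe =>
    ⟨isStarProjection_conj hx (hv1 ▸ hxe), (hv2 ▸ conj_projLE hvp : ProjLE _ f').trans hle⟩
  have hy : ∀ x, IsStarProjection x → ProjLE x e → IsStarProjection (y x) ∧ ProjLE (y x) f :=
    fun x hx hxe => ⟨isStarProjection_sub (hv x hx hxe).1 hf (hv x hx hxe).2,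
      sub_projLE hf (hv x hx hxe).2⟩
  have hw : ∀ x, IsStarProjection x → ProjLE x f →
      IsStarProjection (star w * x * w) ∧ ProjLE (star w * x * w) e := fun x hx hxf =>
    ⟨isStarProjection_conj hx (hw1 ▸ hxf), (hw2 ▸ conj_projLE hwp : ProjLE _ e').trans kle⟩
  have hφ : ∀ x, IsStarProjection x → ProjLE x e → IsStarProjection (φ x) ∧ ProjLE (φ x) e :=
    fun x hx hxe => by
      have h1 := hw _ (hy x hx hxe).1 (hy x hx hxe).2
      exact ⟨isStarProjection_sub h1.1 he h1.2, sub_projLE he h1.2⟩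
  have anti : ∀ a b c : A, IsStarProjection a → IsStarProjection b → IsStarProjection c →
      ProjLE a b → ProjLE b c → ProjLE (c - b) (c - a) := fun a b c ha hb hc hab hbc => by
    unfold ProjLE
    rw [sub_mul, mul_sub, mul_sub, hc.isIdempotentElem.eq, hbc.mul_eq, hab.mul_eq' ha hb,
      (hab.trans hbc).mul_eq' ha hc]
    abel
  have mono : ∀ a b, IsStarProjection a → IsStarProjection b → ProjLE a b → ProjLE b e →
      ProjLE (φ a) (φ b) := fun a b ha hb hab hbe => by
    have hae := hab.trans hbe
    have h1 : ProjLE (y b) (y a) := anti _ _ _ (hv a ha hae).1 (hv b hb hbe).1 hf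
      (conj_mono (hv1 ▸ hae) hab) (hv b hb hbe).2
    have hya := hy a ha hae
    have hyb := hy b hb hbe
    exact anti _ _ _ (hw _ hyb.1 hyb.2).1 (hw _ hya.1 hya.2).1 he
      (conj_mono (hw1 ▸ hyb.2) h1) (hw _ hya.1 hya.2).2
  -- Knaster–Tarski: the supremum of all `x ≤ e` with `x ≤ φ x` is a fixed point of `φ`. Then `e`
  -- splits as `s` plus a copy of `y s`, while `f` splits as a copy of `s` plus `y s`.
  obtain ⟨s, hs⟩ := exists_isJoin
    (fun x : {x : A // IsStarProjection x ∧ ProjLE x e ∧ ProjLE x (φ x)} => (x : A))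
  have hse : ProjLE s e := hs.projLE_of_forall fun x => x.2.2.1
  have h1 : ProjLE s (φ s) := hs.projLE_of_forall fun x =>
    x.2.2.2.trans (mono _ _ x.2.1 hs.1 (hs.projLE x) hse)
  have hφs := hφ s hs.1 hse
  have h2 : ProjLE (φ s) s :=
    hs.projLE ⟨φ s, hφs.1, hφs.2, mono _ _ hs.1 hφs.1 h1 hφs.2⟩
  have hfix : s = φ s := h1.antisymm h2 hs.1 hφs.1
  have hys := hy s hs.1 hse
  have h3 : s + star w * y s * w = e := (sub_eq_iff_eq_add.mp hfix.symm).symm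
  have h4 : star v * s * v + y s = f := add_sub_cancel _ _
  have h5 : s * (star w * y s * w) = 0 := by
    rw [← h3] at hse
    have := hse.mul_eq
    rwa [mul_add, hs.1.isIdempotentElem.eq, add_eq_left] at this
  have := ProjEquiv.add hs.1 (hw _ hys.1 hys.2).1 h5
    (mul_sub_eq_zero_of_projLE (hv s hs.1 hse).1 (hv s hs.1 hse).2)
    (projEquiv_conj hs.1 (hv1 ▸ hse)) (projEquiv_conj hys.1 (hw1 ▸ hys.2)).symm
  rwa [h3, h4] at this

end Joins

/-! ### Generalized comparability of orthogonal projections. -/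

section Comparability

theorem exists_maximal_pairwise {α : Type*} (U : Set α) (r : α → α → Prop) (M₀ : Set α)
    (hU : M₀ ⊆ U) (hr : M₀.Pairwise r) :
    ∃ M, M₀ ⊆ M ∧ M ⊆ U ∧ M.Pairwise r ∧
      ∀ x ∈ U, (∀ y ∈ M, r x y ∧ r y x) → x ∈ M := by
  obtain ⟨M, hM0, hM⟩ := zorn_subset_nonempty {M : Set α | M ⊆ U ∧ M.Pairwise r}
    (fun c hc hchain _ => ⟨⋃₀ c, ⟨Set.sUnion_subset fun s hs => (hc hs).1,
      (Set.pairwise_sUnion hchain.directedOn).mpr fun s hs => (hc hs).2⟩,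
      fun s hs => Set.subset_sUnion_of_mem hs⟩) M₀ ⟨hU, hr⟩
  refine ⟨M, hM0, hM.prop.1, hM.prop.2, fun x hx hxr => ?_⟩
  refine hM.mem_of_prop_insert ⟨Set.insert_subset hx hM.prop.1, ?_⟩
  exact hM.prop.2.insert fun y hy _ => hxr y hy

variable {A : Type u} [CStarAlgebra A]

/-- A nonzero positive element is bounded below on some nonzero projection. -/
theorem exists_projection_mul_mul_eq [IsAWStarAlgebra A] {a : A}
    (ha : ∃ x : A, a = star x * x) (ha0 : a ≠ 0) :
    ∃ p y : A, IsStarProjection p ∧ p ≠ 0 ∧ star y * a * y = p ∧ ∃ b, p = a * b := by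
  let _ : PartialOrder A := CStarAlgebra.spectralOrder A
  have : StarOrderedRing A := CStarAlgebra.spectralOrderedRing A
  have hpos : 0 ≤ a := by obtain ⟨x, rfl⟩ := ha; exact star_mul_self_nonneg x
  have hsa : IsSelfAdjoint a := IsSelfAdjoint.of_nonneg hpos
  have hn : 0 < ‖a‖ := norm_pos_iff.mpr ha0
  -- Any level strictly between 0 and `‖a‖` would do: `c > 0` makes `max(a, c)` invertible, and
  -- `‖a‖` lies in the spectrum, so `h = (a - c)₊` is nonzero. On the annihilator of `k = (c - a)₊`,
  -- `a` agrees with `max(a, c) = a + k`, whose inverse square root is `y`.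
  set c : ℝ := ‖a‖ / 2
  have hc : 0 < c := by positivity
  set k : A := cfc (fun t : ℝ => max (c - t) 0) a
  set h : A := cfc (fun t : ℝ => max (t - c) 0) a
  set y : A := cfc (fun t : ℝ => (√(max t c))⁻¹) a
  have hyc : Continuous (fun t : ℝ => (√(max t c))⁻¹) := by
    refine Continuous.inv₀ (by fun_prop) fun t => ?_
    exact (Real.sqrt_pos.mpr (lt_max_of_lt_right hc)).ne'
  have hkh : k * h = 0 := by
    rw [← cfc_mul _ _ a, ← cfc_const_zero ℝ a]
    refine cfc_congr fun t _ => ?_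
    rcases le_total t c with ht | ht
    · simp [max_eq_right (sub_nonpos.mpr ht)]
    · simp [max_eq_right (sub_nonpos.mpr ht)]
  have hh : h ≠ 0 := by
    intro h0
    have : Nontrivial A := ⟨a, 0, ha0⟩
    have hmem : ‖a‖ ∈ spectrum ℝ a := CStarAlgebra.norm_mem_spectrum_of_nonneg hpos
    have h1 : (spectrum ℝ a).EqOn (fun t : ℝ => max (t - c) 0) (fun _ => 0) :=
      (cfc_eq_cfc_iff_eqOn (a := a)).mp (by rw [cfc_const_zero]; exact h0)
    have := h1 hmem
    have h3 : ‖a‖ - c = c := by simp only [c]; ring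
    simp only [h3, max_eq_left hc.le] at this
    exact hc.ne' this
  have hya : star y = y := (cfc_predicate _ a : IsSelfAdjoint y).star_eq
  have hyay : y * (a + k) * y = 1 := by
    have h1 : a + k = cfc (fun t : ℝ => max t c) a := by
      conv_lhs => lhs; rw [← cfc_id' ℝ a]
      rw [← cfc_add (a := a) (fun t : ℝ => t) (fun t => max (c - t) 0)]
      refine cfc_congr fun t _ => ?_
      rcases le_total t c with ht | ht
      · simp [max_eq_right ht, max_eq_left (sub_nonneg.mpr ht)]
      · simp [max_eq_left ht, max_eq_right (sub_nonpos.mpr ht)]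
    rw [h1, ← cfc_mul _ _ a hyc.continuousOn, ← cfc_mul _ _ a _ hyc.continuousOn,
      ← cfc_const_one ℝ a]
    · refine cfc_congr fun t _ => ?_
      have := Real.sqrt_pos.mpr (lt_max_of_lt_right hc : 0 < max t c)
      have h2 := Real.mul_self_sqrt (lt_max_of_lt_right hc : 0 < max t c).le
      nth_rewrite 2 [← h2]
      field_simp
    · exact hyc.continuousOn.mul (by fun_prop)
  -- `p = 1 - s` projects onto the right annihilator of `k`. It is nonzero since it fixes `h`, and
  -- it commutes with `y` since `k` does.
  obtain ⟨s, hs⟩ := exists_isJoin (fun _ : Unit => k)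
  have hks : k * (1 - s) = 0 := (hs.2 _).mp
    (by rw [mul_sub, hs.1.isIdempotentElem.eq, mul_one, sub_self]) ()
  have hsh : s * h = 0 := hs.mul_eq_zero fun _ => hkh
  set p := 1 - s
  have hp : IsStarProjection p := hs.1.one_sub
  have hcomm : ∀ b : A, Commute k b → IsSelfAdjoint b → Commute p b := by
    intro b hb hbs
    have h1 : s * (b * p) = 0 := hs.mul_eq_zero fun _ => by
      rw [← mul_assoc, hb.eq, mul_assoc, hks, mul_zero]
    have h2 : p * (b * p) = b * p := by rw [sub_mul, one_mul, h1, sub_zero]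
    have h3 := congrArg star h2
    simp only [star_mul, hp.isSelfAdjoint.star_eq, hbs.star_eq] at h3
    change p * b = b * p
    rw [← h2, ← h3, mul_assoc]
  have hka : Commute k a := by
    have := cfc_commute_cfc (fun t : ℝ => max (c - t) 0) id a
    rwa [cfc_id ℝ a] at this
  have hky : Commute k y := cfc_commute_cfc _ _ a
  have hya' : Commute y a := by
    have := cfc_commute_cfc (fun t : ℝ => (√(max t c))⁻¹) id a
    rwa [cfc_id ℝ a] at this
  have hpy := hcomm y hky (cfc_predicate _ a)
  have hp0 : p ≠ 0 := by
    intro h0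
    apply hh
    rw [← one_mul h, ← sub_add_cancel 1 s, add_mul, hsh]
    change p * h + 0 = 0
    rw [h0, zero_mul, zero_add]
  have hyap : y * a * y * p = p := by
    have := congrArg (· * p) hyay
    simp only [one_mul] at this
    rw [mul_add, add_mul, add_mul, mul_assoc (y * k), ← hpy.eq, mul_assoc y k, ← mul_assoc k,
      hks, zero_mul, mul_zero, add_zero] at this
    exact this
  refine ⟨p, y * p, hp, hp0, ?_, y * y * p, ?_⟩
  · rw [star_mul, hya, hp.isSelfAdjoint.star_eq]
    calc p * y * a * (y * p) = p * (y * a * y * p) := by simp only [mul_assoc]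
      _ = p := by rw [hyap, hp.isIdempotentElem.eq]
  · rw [← mul_assoc, ← mul_assoc, ← hya'.eq, hyap]

/-- Nonzero corners contain nonzero equivalent projections. -/
theorem exists_partialIsometry_of_mul_mul_ne_zero [IsAWStarAlgebra A] {e f a : A}
    (he : IsStarProjection e) (hf : IsStarProjection f) (h : e * a * f ≠ 0) :
    ∃ w : A, w ≠ 0 ∧ IsStarProjection (w * star w) ∧ ProjLE (w * star w) e ∧
      ProjLE (star w * w) f := by
  set x := e * a * f with hx
  have hex : e * x = x := by rw [hx, ← mul_assoc, ← mul_assoc, he.isIdempotentElem.eq]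
  have hxf : x * f = x := by rw [hx, mul_assoc, hf.isIdempotentElem.eq]
  have hfx : f * star x = star x := by
    have := congrArg star hxf
    rwa [star_mul, hf.isSelfAdjoint.star_eq] at this
  -- Rescaling by `y` turns `x` into a partial isometry `x * y` with initial projection `p`; the
  -- factorization `p = star x * x * b` places `p` below `f`.
  obtain ⟨p, y, hp, hp0, h1, b, h2⟩ := exists_projection_mul_mul_eq (a := star x * x) ⟨x, rfl⟩
    (by rwa [Ne, CStarRing.star_mul_self_eq_zero_iff])
  have hw : star (x * y) * (x * y) = p := by
    rw [← h1, star_mul]; simp only [mul_assoc]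
  have hpw : IsStarProjection (x * y * star (x * y)) := by
    have := isStarProjection_star_mul (v := star (x * y)) (by rw [star_star, hw]; exact hp)
    rwa [star_star] at this
  refine ⟨x * y, ?_, hpw, ?_, ?_⟩
  · intro h0
    rw [h0, mul_zero] at hw
    exact hp0 hw.symm
  · have h3 : e * (x * y * star (x * y)) = x * y * star (x * y) := by
      rw [← mul_assoc, ← mul_assoc, hex]
    have := congrArg star h3
    rw [star_mul, hpw.isSelfAdjoint.star_eq, he.isSelfAdjoint.star_eq] at this
    exact this.symm
  · rw [hw]
    have h3 : f * p = p := by rw [h2, mul_assoc, ← mul_assoc, hfx]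
    have := congrArg star h3
    rw [star_mul, hp.isSelfAdjoint.star_eq, hf.isSelfAdjoint.star_eq] at this
    exact this.symm

/-- A projection and the central projection supporting the ideal that it generates. -/
theorem exists_central_support [IsAWStarAlgebra A] (e : A) :
    ∃ z : A, IsCentralProjection z ∧ e * z = e ∧
      ∀ x, (∀ a, e * a * x = 0) → z * x = 0 := by
  obtain ⟨s, hs⟩ := exists_isJoin (fun a : A => e * a)
  have h : ∀ a : A, s * (a * (1 - s)) = 0 := fun a => hs.mul_eq_zero fun b => by
    rw [← mul_assoc, mul_assoc e b a]
    exact (hs.2 _).mp (by rw [mul_sub, hs.1.isIdempotentElem.eq, mul_one, sub_self]) _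
  have hc : IsCentralProjection (1 - s) := isCentralProjection_of_mul_mul hs.1.one_sub fun a => by
    rw [sub_mul, one_mul, h, sub_zero]
  refine ⟨s, ?_, ?_, fun x hx => hs.mul_eq_zero hx⟩
  · have := hc.one_sub
    rwa [sub_sub_cancel] at this
  · have := (hs.projLE 1).mul_eq
    rwa [mul_one] at this

/-- Generalized comparability for orthogonal projections. -/
theorem exists_central_comparison [IsAWStarAlgebra A] {e f : A} (he : IsStarProjection e)
    (hf : IsStarProjection f) (hef : e * f = 0) :
    ∃ z : A, IsCentralProjection z ∧ ProjSub (z * e) (z * f) ∧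
      ProjSub ((1 - z) * f) ((1 - z) * e) := by
  -- Take a maximal family of nonzero partial isometries from subprojections of `f` to
  -- subprojections of `e`, with orthogonal initial and orthogonal final projections.
  obtain ⟨M, -, hMU, hM, hmax⟩ := exists_maximal_pairwise
    {w : A | w ≠ 0 ∧ IsStarProjection (w * star w) ∧ ProjLE (w * star w) e ∧
      ProjLE (star w * w) f} (fun w w' => star w * w' = 0 ∧ w * star w' = 0) ∅ (by simp) (by simp)
  have hp : ∀ w : M, IsStarProjection ((w : A) * star (w : A)) := fun w => (hMU w.2).2.1
  have hq : ∀ w : M, IsStarProjection (star (w : A) * (w : A)) :=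
    fun w => isStarProjection_star_mul (hp w)
  obtain ⟨e', he'⟩ := exists_isJoin (fun w : M => (w : A) * star (w : A))
  obtain ⟨f', hf'⟩ := exists_isJoin (fun w : M => star (w : A) * (w : A))
  have hee : ProjLE e' e := he'.projLE_of_forall fun w => (hMU w.2).2.2.1
  have hff : ProjLE f' f := hf'.projLE_of_forall fun w => (hMU w.2).2.2.2
  have hequiv : ProjEquiv e' f' := by
    refine he'.projEquiv hf' hp (fun i j hij => ?_) (fun i j hij => ?_) (fun i j => ?_)
      fun i => ⟨i, rfl, rfl⟩
    · have := (hM i.2 j.2 (Subtype.coe_injective.ne hij)).1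
      rw [mul_assoc, ← mul_assoc (star (i : A)), this, zero_mul, mul_zero]
    · have := (hM i.2 j.2 (Subtype.coe_injective.ne hij)).2
      rw [mul_assoc, ← mul_assoc (i : A), this, zero_mul, mul_zero]
    · exact mul_eq_zero_of_projLE (hMU i.2).2.2.1 hf (hq j) (hMU j.2).2.2.2 hef
  have hzero : ∀ a, (e - e') * a * (f - f') = 0 := by
    by_contra! hne
    obtain ⟨a, ha⟩ := hne
    obtain ⟨w, hw0, hw1, hw2, hw3⟩ := exists_partialIsometry_of_mul_mul_ne_zero
      (isStarProjection_sub he'.1 he hee) (isStarProjection_sub hf'.1 hf hff) ha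
    have hsw := mul_star_mul_self hw1
    have hws : star w * (w * star w) = star w := by
      have := congrArg star hsw
      simpa only [star_mul, star_star] using this
    have hw4 := isStarProjection_star_mul hw1
    have hwe : (w * star w) * e' = 0 := mul_eq_zero_of_projLE hw2 he'.1 he'.1 (ProjLE.refl he'.1)
      (sub_mul_eq_zero_of_projLE he'.1 he hee)
    have hwf : (star w * w) * f' = 0 := mul_eq_zero_of_projLE hw3 hf'.1 hf'.1 (ProjLE.refl hf'.1)
      (sub_mul_eq_zero_of_projLE hf'.1 hf hff)
    have hwM : w ∈ M := by
      refine hmax w ⟨hw0, hw1, hw2.trans (sub_projLE he hee), hw3.trans (sub_projLE hf hff)⟩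
        fun w' hw' => ?_
      have k1 := (he'.projLE ⟨w', hw'⟩).mul_eq' (hp ⟨w', hw'⟩) he'.1
      have k2 := (hf'.projLE ⟨w', hw'⟩).mul_eq' (hq ⟨w', hw'⟩) hf'.1
      have m1 := mul_star_mul_self (hp ⟨w', hw'⟩)
      have m2 : star w' * (w' * star w') = star w' := by
        have := congrArg star m1
        simpa only [star_mul, star_star] using this
      simp only at k1 k2 m1
      have n1 : star w * w' = 0 := by
        rw [← m1, ← k1, ← hws]
        calc _ = star w * ((w * star w) * e') * (w' * star w' * w') := by simp only [mul_assoc]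
          _ = 0 := by rw [hwe, mul_zero, zero_mul]
      have n2 : w * star w' = 0 := by
        rw [← m2, ← mul_assoc (star w'), ← k2, ← hsw]
        calc _ = w * ((star w * w) * f') * (star w' * w' * star w') := by simp only [mul_assoc]
          _ = 0 := by rw [hwf, mul_zero, zero_mul]
      have n3 := congrArg star n1
      have n4 := congrArg star n2
      simp only [star_mul, star_star, star_zero] at n3 n4
      exact ⟨⟨n1, n2⟩, n3, n4⟩
    have := (he'.projLE ⟨w, hwM⟩).mul_eq
    rw [hwe] at this
    rw [← this, zero_mul] at hsw
    exact hw0 hsw.symm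
  -- By maximality no nonzero corner joins the leftovers, so they are centrally separated: `z` kills
  -- `f - f'` and `1 - z` kills `e - e'`. Each half then inherits `e' ∼ f'`.
  obtain ⟨z, hz, hz1, hz2⟩ := exists_central_support (e - e')
  have h1 : z * f = z * f' := by
    have := hz2 _ hzero
    rwa [mul_sub, sub_eq_zero] at this
  have h2 : (1 - z) * e = (1 - z) * e' := by
    rw [← sub_eq_zero, ← mul_sub, ← hz.one_sub.comm, mul_sub, mul_one, hz1, sub_self]
  refine ⟨1 - z, hz.one_sub, ?_, ?_⟩
  · rw [h2]
    exact ⟨(1 - z) * f', hz.one_sub.isStarProjection_mul hf'.1, hequiv.central_mul hz.one_sub,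
      hff.central_mul hz.one_sub⟩
  · rw [sub_sub_cancel, h1]
    exact ⟨z * e', hz.isStarProjection_mul he'.1, hequiv.symm.central_mul hz, hee.central_mul hz⟩

end Comparability

/-! ### Decompositions into copies of a projection, and their cardinalities. -/

section Decompositions

variable {A : Type u} [CStarAlgebra A]

/-- `F` is the orthogonal sum of a family of copies of `s` and a remainder `r ≾ s`. -/
structure IsCopyDecomposition {ι : Type*} (p : ι → A) (r s F : A) : Prop where
  isStarProjection : ∀ i, IsStarProjection (p i)
  orthogonal : ∀ i j, i ≠ j → p i * p j = 0
  equiv : ∀ i, ProjEquiv (p i) s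
  rest : IsStarProjection r
  rest_mul : ∀ i, r * p i = 0
  rest_sub : ProjSub r s
  isJoin : IsJoin (fun o : Option ι => o.elim r p) F

theorem IsCopyDecomposition.projLE {ι : Type*} {p : ι → A} {r s F : A}
    (D : IsCopyDecomposition p r s F) (i : ι) : ProjLE (p i) F :=
  D.isJoin.projLE (some i)

/-- Orthogonal nonzero members are distinct elements of `A`. The bound ensures that the infimum
defining `dim` is over a nonempty set. -/
theorem le_mk_of_mem_decompositionCardinals {F : A} (hF : F ≠ 0) {α : Cardinal.{u}}
    (h : α ∈ decompositionCardinals F) : α ≤ Cardinal.mk A := by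
  obtain ⟨ι, p, ⟨hp, ho, -⟩, he, rfl⟩ := h
  refine Cardinal.mk_le_of_injective (f := p) fun i j hij => ?_
  by_contra hne
  have h0 := ho i j hne
  rw [← hij, (hp i).isIdempotentElem.eq] at h0
  have := (he i).symm
  rw [h0] at this
  exact hF this.eq_zero

theorem lt_dim {F : A} (hF : F ≠ 0) {α : Cardinal.{u}} (h : α ∈ decompositionCardinals F) :
    α < dim F := by
  rw [dim, if_neg hF]
  have hne : {κ : Cardinal.{u} | ∀ α ∈ decompositionCardinals F, α < κ}.Nonempty :=
    ⟨Order.succ (Cardinal.mk A), fun α hα =>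
      Order.lt_succ_of_le (le_mk_of_mem_decompositionCardinals hF hα)⟩
  exact csInf_mem hne α h

theorem exists_le_of_lt_dim {F : A} (hF : F ≠ 0) {α : Cardinal.{u}} (h : α < dim F) :
    ∃ β ∈ decompositionCardinals F, α ≤ β := by
  rw [dim, if_neg hF] at h
  by_contra! hlt
  exact h.not_ge (csInf_le' hlt)

variable [IsAWStarAlgebra A]

/-- A family of orthogonal copies of `s` below `G` extends, over some central projection, to a
decomposition of `G` into copies of `s` and a remainder. -/
theorem exists_isCopyDecomposition {G s : A} (hG : IsStarProjection G) (hs : IsStarProjection s)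
    (hs0 : s ≠ 0) {M₀ : Set A} (hne : M₀.Nonempty)
    (hM₀ : ∀ x ∈ M₀, IsStarProjection x ∧ ProjLE x G ∧ ProjEquiv x s)
    (ho : M₀.Pairwise fun x y => x * y = 0) :
    ∃ z : A, IsCentralProjection z ∧ z * s ≠ 0 ∧ ∃ (ι : Type u) (p : ι → A) (r : A),
      Cardinal.mk M₀ ≤ Cardinal.mk ι ∧ IsCopyDecomposition p r (z * s) (z * G) := by
  obtain ⟨M, hM₀M, hMU, hM, hmax⟩ := exists_maximal_pairwise
    {x : A | IsStarProjection x ∧ ProjLE x G ∧ ProjEquiv x s} (fun x y => x * y = 0) M₀ hM₀ ho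
  obtain ⟨S, hS⟩ := exists_isJoin (fun x : M => (x : A))
  have hSG : ProjLE S G := hS.projLE_of_forall fun x => (hMU x.2).2.1
  have hr := isStarProjection_sub hS.1 hG hSG
  have hrS := sub_mul_eq_zero_of_projLE hS.1 hG hSG
  obtain ⟨m, hm⟩ := hne
  have hmM := hM₀M hm
  obtain ⟨hm1, hm2, hm3⟩ := hMU hmM
  have hrm : ∀ x : M, (G - S) * x = 0 := fun x =>
    mul_eq_zero_of_projLE (ProjLE.refl hr) hS.1 (hMU x.2).1 (hS.projLE x) hrS
  -- Compare the remainder with one member `m`. If `z * s` were zero, all of `m` would embed in the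
  -- remainder, giving a further copy of `s` against maximality.
  obtain ⟨z, hz, hz1, hz2⟩ := exists_central_comparison hr hm1 (hrm ⟨m, hmM⟩)
  have hzs : z * s ≠ 0 := by
    intro h0
    have hzm : z * m = 0 := ((h0 ▸ hm3.central_mul hz : ProjEquiv (z * m) 0)).eq_zero
    rw [sub_mul, one_mul, hzm, sub_zero] at hz2
    obtain ⟨s', h1, h2, h3⟩ := hz2
    have h4 : ProjLE s' (G - S) := h3.trans (mul_projLE_right _ hr)
    have h5 : s' * S = 0 := mul_eq_zero_of_projLE h4 hS.1 hS.1 (ProjLE.refl hS.1) hrS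
    have h6 : s' ∈ M := by
      refine hmax s' ⟨h1, h4.trans (sub_projLE hG hSG), h2.symm.trans hm3 h1⟩ fun y hy => ?_
      have : s' * y = 0 :=
        mul_eq_zero_of_projLE (ProjLE.refl h1) hS.1 (hMU hy).1 (hS.projLE ⟨y, hy⟩) h5
      exact ⟨this, IsStarProjection.orthogonal_symm h1 (hMU hy).1 this⟩
    have h7 : s' = 0 := (hS.projLE ⟨s', h6⟩).mul_eq.symm.trans h5
    rw [h7] at h2
    have h8 := hm3.symm.trans h2 hs
    exact hs0 h8.eq_zero
  have hzm : ProjEquiv (z * m) (z * s) := hm3.central_mul hz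
  refine ⟨z, hz, hzs, M, fun x => z * x, z * (G - S), Cardinal.mk_le_mk_of_subset hM₀M,
    fun x => hz.isStarProjection_mul (hMU x.2).1, fun x y hxy => ?_,
    fun x => (hMU x.2).2.2.central_mul hz, hz.isStarProjection_mul hr, fun x => ?_, ?_, ?_⟩
  · rw [hz.mul_mul_mul, hM x.2 y.2 (Subtype.coe_injective.ne hxy), mul_zero]
  · rw [hz.mul_mul_mul, hrm, mul_zero]
  · exact hz1.trans (hzm.projSub (hz.isStarProjection_mul hm1)) (hz.isStarProjection_mul hr)
      (hz.isStarProjection_mul hm1)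
  · have := (IsJoin.option hr hS hrS).central_mul hz
    rw [sub_add_cancel] at this
    convert this using 2 with o
    cases o <;> rfl

/-- Removing the copies indexed by `t` from a decomposition leaves a projection that is dominated
by every sufficiently large sum of copies. -/
theorem IsCopyDecomposition.exists_compl {ι κ : Type*} {p : ι → A} {r s F a : A}
    (D : IsCopyDecomposition p r s F) {t : κ → ι} (ha : IsJoin (p ∘ t) a) :
    ∃ c, IsStarProjection c ∧ c * a = 0 ∧ F = c + a ∧
      ∀ {μ : Type _} (q : μ → A) (X : A), IsJoin q X → (∀ k, IsStarProjection (q k)) →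
        (∀ k l, k ≠ l → q k * q l = 0) → (∀ k, ProjEquiv (q k) s) → ProjLE X a →
        Nonempty (Option ((Set.range t)ᶜ : Set ι) ↪ μ) → ProjSub c X := by
  obtain ⟨S, hS⟩ := exists_isJoin p
  obtain ⟨b, hb⟩ := exists_isJoin (fun i : ((Set.range t)ᶜ : Set ι) => p i)
  obtain ⟨hba, hSab⟩ := hS.eq_add_compl D.isStarProjection D.orthogonal ha hb
  have hrS : r * S = 0 := hS.mul_eq_zero' D.isStarProjection D.rest_mul
  have hra : r * a = 0 := ha.mul_eq_zero' (fun _ => D.isStarProjection _) fun _ => D.rest_mul _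
  have hrb : r * b = 0 := hb.mul_eq_zero' (fun _ => D.isStarProjection _) fun _ => D.rest_mul _
  have hF : F = r + S := D.isJoin.eq (IsJoin.option D.rest hS hrS)
  have hc := IsJoin.option D.rest hb hrb
  have hca : (r + b) * a = 0 := by rw [add_mul, hra, hba, add_zero]
  refine ⟨r + b, hc.1, hca, by rw [hF, hSab, add_assoc], ?_⟩
  rintro μ q X hX hq hqo hqs hXa ⟨φ⟩
  have hop : ∀ o : Option ((Set.range t)ᶜ : Set ι),
      IsStarProjection (o.elim r (fun i : ((Set.range t)ᶜ : Set ι) => p i)) := by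
    rintro (_ | i)
    exacts [D.rest, D.isStarProjection _]
  refine IsJoin.projSub hc hX hop hq ?_ hqo (fun o k => ?_) φ ?_
  · rintro (_ | i) (_ | j) hij
    · exact absurd rfl hij
    · exact D.rest_mul _
    · exact IsStarProjection.orthogonal_symm D.rest (D.isStarProjection _) (D.rest_mul _)
    · exact D.orthogonal _ _ fun h => hij (congrArg some (Subtype.ext h))
  · exact mul_eq_zero_of_projLE (hc.projLE o) ha.1 (hq k) ((hX.projLE k).trans hXa) hca
  · have hs := fun k => (hqs k).symm.projSub ((hqs k).isStarProjection (hq k))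
    rintro (_ | i)
    · exact D.rest_sub.trans (hs _) D.rest ((hqs (φ none)).isStarProjection (hq _))
    · exact ((D.equiv i).trans (hqs _).symm (D.isStarProjection _)).projSub (D.isStarProjection _)

/-- An infinite sum of copies of `s`, with a remainder dominated by `s`, contains equally many
copies of itself. -/
theorem IsCopyDecomposition.exists_copies {ι : Type u} [Infinite ι] {p : ι → A} {r s F : A}
    (D : IsCopyDecomposition p r s F) :
    ∃ q : ι → A, (∀ i, IsStarProjection (q i)) ∧ (∀ i j, i ≠ j → q i * q j = 0) ∧
      (∀ i, ProjEquiv (q i) F) ∧ ∀ i, ProjLE (q i) F := by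
  -- The index set is cut into `ι` many pairs of blocks, each block of size `|ι|`. One block alone
  -- would suffice for `F`, but two orthogonal blocks keep every use of additivity between
  -- orthogonal families.
  have hcard : Cardinal.mk (ι × Bool × ι) = Cardinal.mk ι := by
    have hι : Cardinal.aleph0 ≤ Cardinal.mk ι := Cardinal.infinite_iff.mp inferInstance
    simp only [Cardinal.mk_prod, Cardinal.lift_id, Cardinal.lift_uzero, Cardinal.mk_bool]
    rw [Cardinal.mul_eq_right hι (by simpa using (Cardinal.natCast_lt_aleph0 (n := 2)).le.trans hι)
      (by simp), Cardinal.mul_eq_self hι]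
  obtain ⟨φ⟩ := Cardinal.eq.mp hcard
  have hopt : Cardinal.mk (Option ι) = Cardinal.mk ι := by
    rw [Cardinal.mk_option, Cardinal.add_one_eq (Cardinal.infinite_iff.mp inferInstance)]
  choose S hS using fun (i : ι) (b : Bool) => exists_isJoin (p ∘ fun j => φ (i, b, j))
  have hpo : ∀ i b i' b', (i, b) ≠ (i', b') → S i b * S i' b' = 0 := fun i b i' b' h =>
    (hS i b).mul_eq_zero fun j => (hS i' b').mul_eq_zero' (fun _ => D.isStarProjection _) fun k =>
      D.orthogonal _ _ fun e => h (by
        have := φ.injective e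
        simp only [Prod.mk.injEq] at this ⊢
        exact ⟨this.1, this.2.1⟩)
  have hSF : ∀ i b, ProjLE (S i b) F := fun i b => (hS i b).projLE_of_forall fun j => D.projLE _
  have hone : ∀ i, S i true * S i false = 0 := fun i => hpo _ _ _ _ (by simp)
  have hq : ∀ i, IsStarProjection (S i true + S i false) := fun i =>
    isStarProjection_add (hS i true).1 (hS i false).1 (hone i)
  refine ⟨fun i => S i true + S i false, hq, fun i j hij => ?_, fun i => ?_,
    fun i => (hSF i _).add (hSF i _)⟩
  · simp only [add_mul, mul_add, hpo i _ j _ (by simp [hij]), add_zero]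
  · have hequiv : ProjEquiv (S i true) (S i false) := by
      refine (hS i true).projEquiv (hS i false) (fun _ => D.isStarProjection _) ?_ ?_ ?_ ?_
      · exact fun j k hjk => D.orthogonal _ _ (by simpa using hjk)
      · exact fun j k hjk => D.orthogonal _ _ (by simpa using hjk)
      · exact fun j k => D.orthogonal _ _ (by simp)
      · exact fun j => (D.equiv _).trans (D.equiv _).symm (D.isStarProjection _)
    obtain ⟨c, hc, hca, hF, hsub⟩ := D.exists_compl (hS i true)
    have h1 : ProjSub c (S i true) := by
      refine hsub _ _ (hS i true) (fun _ => D.isStarProjection _)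
        (fun j k hjk => D.orthogonal _ _ (by simpa using hjk)) (fun _ => D.equiv _)
        (ProjLE.refl (hS i true).1) ?_
      rw [← Cardinal.le_def, ← hopt]
      exact Cardinal.mk_le_of_injective (Option.map_injective Subtype.val_injective)
    -- Shift: the complement of the `true` block embeds in that block, which in turn moves to the
    -- `false` block.
    have h2 : ProjSub F (S i true + S i false) := by
      conv_lhs => rw [hF]
      exact h1.add hc (hS i true).1 (hS i true).1 (hS i false).1 hca (hone i)
        (hequiv.projSub (hS i true).1)
    exact (((hSF i true).add (hSF i false)).projSub (hq i)).antisymm (hq i) D.isJoin.1 h2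

/-- A nonempty family of orthogonal copies of `F` below `F` can be enlarged to a decomposition
of `F`. -/
theorem mk_mem_decompositionCardinals {ι : Type u} [Nonempty ι] {q : ι → A} {F : A}
    (hF : IsStarProjection F) (hq : ∀ i, IsStarProjection (q i))
    (ho : ∀ i j, i ≠ j → q i * q j = 0) (he : ∀ i, ProjEquiv (q i) F)
    (hle : ∀ i, ProjLE (q i) F) : Cardinal.mk ι ∈ decompositionCardinals F := by
  classical
  obtain ⟨S, hS⟩ := exists_isJoin q
  have hSF : ProjLE S F := hS.projLE_of_forall hle
  have hr := isStarProjection_sub hS.1 hF hSF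
  have hrq : ∀ i, (F - S) * q i = 0 := fun i => mul_eq_zero_of_projLE (ProjLE.refl hr) hS.1
    (hq i) (hS.projLE i) (sub_mul_eq_zero_of_projLE hS.1 hF hSF)
  have hqr : ∀ i, q i * (F - S) = 0 := fun i =>
    IsStarProjection.orthogonal_symm hr (hq i) (hrq i)
  obtain ⟨i₀⟩ := ‹Nonempty ι›
  -- One member absorbs the leftover `F - S`; lying between a copy of `F` and `F`, it is still
  -- equivalent to `F`.
  set q' : ι → A := Function.update q i₀ (q i₀ + (F - S)) with hq'
  have hu : ∀ i, i ≠ i₀ → q' i = q i := fun i hi => Function.update_of_ne hi _ _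
  have hu0 : q' i₀ = q i₀ + (F - S) := Function.update_self _ _ _
  have h0 : IsStarProjection (q' i₀) := by
    rw [hu0]; exact isStarProjection_add (hq i₀) hr (hqr i₀)
  have hp' : ∀ i, IsStarProjection (q' i) := fun i => by
    by_cases hi : i = i₀
    · rw [hi]; exact h0
    · rw [hu i hi]; exact hq i
  have hle' : ∀ i, ProjLE (q' i) F := fun i => by
    by_cases hi : i = i₀
    · rw [hi, hu0]; exact (hle i₀).add (sub_projLE hF hSF)
    · rw [hu i hi]; exact hle i
  have he0 : ProjEquiv (q' i₀) F := by
    refine ((hle' i₀).projSub h0).antisymm h0 hF ⟨q i₀, hq i₀, (he i₀).symm, ?_⟩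
    rw [hu0]; exact projLE_add_left (hq i₀) (hqr i₀)
  have ho0 : ∀ i, i ≠ i₀ → q' i₀ * q' i = 0 := fun i hi => by
    rw [hu0, hu i hi, add_mul, ho _ _ hi.symm, hrq, add_zero]
  have hjoin : IsJoin q' F := by
    refine ⟨hF, fun x => ⟨fun hx i => ?_, fun hx => ?_⟩⟩
    · rw [← (hle' i).mul_eq, mul_assoc, hx, mul_zero]
    · have h1 := hx i₀
      rw [hu0] at h1
      have h2 := congrArg (q i₀ * ·) h1
      simp only [← mul_assoc, mul_add, hqr, (hq i₀).isIdempotentElem.eq, add_zero, mul_zero] at h2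
      rw [add_mul, h2, zero_add] at h1
      have h3 : S * x = 0 := hS.mul_eq_zero fun i => by
        by_cases hi : i = i₀
        · rw [hi, h2]
        · rw [← hu i hi, hx]
      rwa [sub_mul, h3, sub_zero] at h1
  refine ⟨ι, q', hjoin.isOrthogonalSum hp' fun i j hij => ?_, fun i => ?_, rfl⟩
  · by_cases hi : i = i₀
    · subst hi; exact ho0 j hij.symm
    · by_cases hj : j = i₀
      · subst hj; exact IsStarProjection.orthogonal_symm h0 (hp' i) (ho0 i hi)
      · rw [hu i hi, hu j hj, ho i j hij]
  · by_cases hi : i = i₀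
    · rw [hi]; exact he0
    · rw [hu i hi]; exact he i

end Decompositions

/-! ### Central exhaustion, halving, and dimension estimates. -/

section Exhaustion

variable {A : Type u} [CStarAlgebra A]

theorem IsJoin.add {ι : Type*} {p q : ι → A} {s t : A} (hp : IsJoin p s) (hq : IsJoin q t)
    (pp : ∀ i, IsStarProjection (p i)) (qq : ∀ i, IsStarProjection (q i))
    (hpq : ∀ i j, p i * q j = 0) : IsJoin (fun i => p i + q i) (s + t) := by
  have hst : s * t = 0 := hp.mul_eq_zero fun i => hq.mul_eq_zero' qq (hpq i)
  have key : ∀ {a b : A}, IsStarProjection a → IsStarProjection b → a * b = 0 → ∀ x,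
      (a + b) * x = 0 ↔ a * x = 0 ∧ b * x = 0 := fun {a b} ha hb hab x => by
    refine ⟨fun hx => ?_, fun ⟨h1, h2⟩ => by rw [add_mul, h1, h2, add_zero]⟩
    have h1 := congrArg (a * ·) hx
    have h2 := congrArg (b * ·) hx
    simp only [← mul_assoc, mul_add, hab, IsStarProjection.orthogonal_symm ha hb hab,
      ha.isIdempotentElem.eq, hb.isIdempotentElem.eq, add_zero, zero_add, mul_zero] at h1 h2
    exact ⟨h1, h2⟩
  refine ⟨isStarProjection_add hp.1 hq.1 hst, fun x => ?_⟩
  rw [key hp.1 hq.1 hst, hp.2, hq.2, ← forall_and]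
  exact forall_congr' fun i => (key (pp i) (qq i) (hpq i i) x).symm

theorem projSub_add_of_halving {e a b x y : A} (ha : IsStarProjection a)
    (hb : IsStarProjection b) (he : IsStarProjection e) (hab : a * b = 0) (hae : ProjLE a e)
    (hbe : ProjLE b e) (ea : ProjEquiv a e) (eb : ProjEquiv b e) (hx : IsStarProjection x)
    (hy : IsStarProjection y) (hxy : x * y = 0) (hxe : ProjSub x e) (hye : ProjSub y e) :
    ProjSub (x + y) e := by
  have h := ProjSub.add hx hy ha hb hxy hab (hxe.trans (ea.symm.projSub he) hx he)
    (hye.trans (eb.symm.projSub he) hy he)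
  exact h.trans ((hae.add hbe).projSub (isStarProjection_add ha hb hab))
    (isStarProjection_add hx hy hxy) (isStarProjection_add ha hb hab)

variable [IsAWStarAlgebra A]

/-- A property that holds locally on central projections holds on the members of a central
partition. -/
theorem exists_central_partition {f : A} (hf : IsStarProjection f) {P : A → Prop}
    (h : ∀ y : A, IsCentralProjection y → y * f ≠ 0 →
      ∃ z, IsCentralProjection z ∧ z * y * f ≠ 0 ∧ P (z * y)) :
    ∃ Z : Set A, (∀ z ∈ Z, IsCentralProjection z ∧ P z) ∧ (Z.Pairwise fun z w => z * w = 0) ∧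
      IsJoin (fun z : Z => (z : A) * f) f := by
  obtain ⟨Z, -, hZU, hZ, hmax⟩ := exists_maximal_pairwise
    {z : A | IsCentralProjection z ∧ z * f ≠ 0 ∧ P z} (fun z w => z * w = 0) ∅ (by simp) (by simp)
  obtain ⟨c, hc⟩ := exists_isJoin (fun z : Z => (z : A))
  have hcc : IsCentralProjection c := isCentralProjection_of_mul_mul hc.1 fun a => by
    have h2 : c * (star a * (1 - c)) = 0 := hc.mul_eq_zero fun z => by
      rw [← mul_assoc, ← (hZU z.2).1.comm, mul_assoc, mul_sub, mul_one, (hc.projLE z).mul_eq,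
        sub_self, mul_zero]
    have h3 := congrArg star h2
    simp only [star_mul, star_star, hc.1.isSelfAdjoint.star_eq, star_zero, star_sub, star_one,
      sub_mul, one_mul, mul_assoc] at h3
    exact (sub_eq_zero.mp h3).symm
  have hcf : (1 - c) * f = 0 := by
    by_contra hne
    obtain ⟨z, hz, hz0, hzP⟩ := h _ hcc.one_sub hne
    have hw := hz.mul hcc.one_sub
    have hwc : z * (1 - c) * c = 0 := by
      rw [mul_assoc, sub_mul, one_mul, hc.1.isIdempotentElem.eq, sub_self, mul_zero]
    have hmem : z * (1 - c) ∈ Z := hmax _ ⟨hw, hz0, hzP⟩ fun y hy => by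
      have : z * (1 - c) * y = 0 := mul_eq_zero_of_projLE (ProjLE.refl hw.1) hc.1 (hZU hy).1.1
        (hc.projLE ⟨y, hy⟩) hwc
      exact ⟨this, IsStarProjection.orthogonal_symm hw.1 (hZU hy).1.1 this⟩
    have : z * (1 - c) = 0 := (hc.projLE ⟨_, hmem⟩).mul_eq.symm.trans hwc
    exact hz0 (by rw [this, zero_mul])
  refine ⟨Z, fun z hz => ⟨(hZU hz).1, (hZU hz).2.2⟩, hZ, hf, fun x => ⟨fun hx z => ?_, fun hx => ?_⟩⟩
  · rw [mul_assoc, hx, mul_zero]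
  · have : c * (f * x) = 0 := hc.mul_eq_zero fun z => by rw [← mul_assoc, hx]
    rw [← mul_assoc] at this
    rw [sub_mul, one_mul, sub_eq_zero] at hcf
    rwa [hcf]

/-- A projection split into three equivalent pieces, each absorbing one further copy. -/
structure IsAbsorbingTriple (f a b c : A) : Prop where
  isStarProjection : IsStarProjection a ∧ IsStarProjection b ∧ IsStarProjection c
  orthogonal : a * b = 0 ∧ a * c = 0 ∧ b * c = 0
  sum : a + b + c = f
  equiv : ProjEquiv a b ∧ ProjEquiv a c ∧ ProjEquiv (a + b) c

/-- The third copy `d` lies in `f - (a + b)`, so Schröder–Bernstein makes this rest equivalent to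
`f`, and then also to `a + b`. -/
theorem isAbsorbingTriple_of_copies {f a b d : A} (hf : IsStarProjection f)
    (ha : IsStarProjection a) (hb : IsStarProjection b) (hd : IsStarProjection d)
    (hab : a * b = 0) (had : a * d = 0) (hbd : b * d = 0)
    (haf : ProjLE a f) (hbf : ProjLE b f) (hdf : ProjLE d f)
    (ea : ProjEquiv a f) (eb : ProjEquiv b f) (ed : ProjEquiv d f) :
    IsAbsorbingTriple f a b (f - (a + b)) := by
  have hs := isStarProjection_add ha hb hab
  have hsf := haf.add hbf
  have hc := isStarProjection_sub hs hf hsf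
  have hcf := sub_projLE hf hsf
  have h0 := mul_sub_eq_zero_of_projLE hs hsf
  have hdc : ProjLE d (f - (a + b)) := hdf.le_sub (by
    rw [mul_add, IsStarProjection.orthogonal_symm ha hd had,
      IsStarProjection.orthogonal_symm hb hd hbd, add_zero])
  have ec : ProjEquiv (f - (a + b)) f :=
    (hcf.projSub hc).antisymm hc hf ⟨d, hd, ed.symm, hdc⟩
  have eac : ProjEquiv a (f - (a + b)) := ea.trans ec.symm ha
  refine ⟨⟨ha, hb, hc⟩, ⟨hab, ?_, ?_⟩, add_sub_cancel _ _, ea.trans eb.symm ha, eac, ?_⟩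
  · exact mul_eq_zero_of_projLE (projLE_add_left ha hab) hc hc (ProjLE.refl hc) h0
  · exact mul_eq_zero_of_projLE
      (projLE_add_right hb (IsStarProjection.orthogonal_symm ha hb hab)) hc hc (ProjLE.refl hc) h0
  · refine ProjSub.antisymm hs hc ?_ ⟨a, ha, eac.symm, projLE_add_left ha hab⟩
    exact (hsf.projSub hs).trans (ec.symm.projSub hf) hs hf

/-- A properly infinite projection contains two orthogonal copies of itself. -/
theorem IsProperlyInfinite.exists_halving {f : A} (h : IsProperlyInfinite f) :
    ∃ a b : A, IsStarProjection a ∧ IsStarProjection b ∧ a * b = 0 ∧ ProjLE a f ∧ ProjLE b f ∧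
      ProjEquiv a f ∧ ProjEquiv b f := by
  obtain ⟨hf, -, hinf⟩ := h
  obtain ⟨Z, hZ, hZo, hj⟩ := exists_central_partition hf
      (P := fun z => ∃ a b c, IsAbsorbingTriple (z * f) a b c) fun y hy hy0 => by
    have hG := hy.isStarProjection_mul hf
    obtain hfin := (hinf y hy).resolve_left hy0
    simp only [IsFiniteProj, not_forall] at hfin
    obtain ⟨g, hg, heq, hle, hne⟩ := hfin
    have hs := isStarProjection_sub hg hG hle
    have hs0 : y * f - g ≠ 0 := sub_ne_zero.mpr hne
    obtain ⟨p, hp, hpG, hps, hpo⟩ := exists_orthogonal_sequence hG heq hle hs (sub_projLE hG hle)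
      (sub_mul_eq_zero_of_projLE hg hG hle)
    have hinj : Function.Injective p := fun m n hmn => by
      by_contra hne
      have h0 := hpo m n hne
      rw [← hmn, (hp m).isIdempotentElem.eq] at h0
      have := (hps m).symm
      rw [h0] at this
      exact hs0 this.eq_zero
    obtain ⟨z, hz, hzs, ι, q, r, hcard, D⟩ := exists_isCopyDecomposition hG hs hs0
      (M₀ := Set.range p) (Set.range_nonempty p)
      (by rintro _ ⟨n, rfl⟩; exact ⟨hp n, hpG n, hps n⟩)
      (by rintro _ ⟨m, rfl⟩ _ ⟨n, rfl⟩ hmn; exact hpo m n fun h => hmn (congrArg p h))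
    have : Infinite (Set.range p) := (Set.infinite_range_of_injective hinj).to_subtype
    have : Infinite ι := Cardinal.infinite_iff.mpr
      ((Cardinal.infinite_iff.mp inferInstance).trans hcard)
    obtain ⟨k, hk, hko, hke, hkF⟩ := D.exists_copies
    let φ := Infinite.natEmbedding ι
    have hφ : ∀ m n, m ≠ n → k (φ m) * k (φ n) = 0 := fun m n hmn =>
      hko _ _ (φ.injective.ne hmn)
    refine ⟨z, hz, fun h0 => hzs ?_, ?_⟩
    · rw [← (sub_projLE hG hle).mul_eq' hs hG, ← mul_assoc, ← mul_assoc, h0, zero_mul]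
    · rw [mul_assoc]
      exact ⟨_, _, _, isAbsorbingTriple_of_copies D.isJoin.1 (hk (φ 0)) (hk (φ 1)) (hk (φ 2))
        (hφ _ _ (by simp)) (hφ _ _ (by simp)) (hφ _ _ (by simp)) (hkF _) (hkF _) (hkF _)
        (hke _) (hke _) (hke _)⟩
  choose a b c T using fun z : Z => (hZ z z.2).2
  have pa := fun z => (T z).isStarProjection.1
  have pb := fun z => (T z).isStarProjection.2.1
  have pc := fun z => (T z).isStarProjection.2.2
  have hzf := fun z : Z => (hZ z z.2).1.isStarProjection_mul hf
  have sum := fun z => (T z).sum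
  have hab := fun z => (T z).orthogonal.1
  have hac := fun z => (T z).orthogonal.2.1
  have hbc := fun z => (T z).orthogonal.2.2
  have pab := fun z => isStarProjection_add (pa z) (pb z) (hab z)
  have habc : ∀ z, (a z + b z) * c z = 0 := fun z => by rw [add_mul, hac, hbc, add_zero]
  have lab : ∀ z : Z, ProjLE (a z + b z) (z * f) := fun z => by
    rw [← sum]; exact projLE_add_left (pab z) (habc z)
  have la : ∀ z : Z, ProjLE (a z) (z * f) := fun z => (projLE_add_left (pa z) (hab z)).trans (lab z)
  have lb : ∀ z : Z, ProjLE (b z) (z * f) := fun z => (projLE_add_right (pb z)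
    (IsStarProjection.orthogonal_symm (pa z) (pb z) (hab z))).trans (lab z)
  have lc : ∀ z : Z, ProjLE (c z) (z * f) := fun z => by
    rw [← sum]; exact projLE_add_right (pc z)
      (IsStarProjection.orthogonal_symm (pab z) (pc z) (habc z))
  have ortho : ∀ {p q : Z → A}, (∀ z, IsStarProjection (q z)) →
      (∀ z : Z, ProjLE (p z) (z * f)) → (∀ z : Z, ProjLE (q z) (z * f)) →
      ∀ z w, z ≠ w → p z * q w = 0 := fun {p q} hq lp lq z w hzw => by
    refine mul_eq_zero_of_projLE (lp z) (hzf w) (hq w) (lq w) ?_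
    rw [mul_assoc, ← mul_assoc f, (hZ w w.2).1.comm f, mul_assoc (w : A), ← mul_assoc (z : A),
      hZo z.2 w.2 (Subtype.coe_injective.ne hzw), zero_mul]
  have ortho' : ∀ {p q : Z → A}, (∀ z, IsStarProjection (q z)) →
      (∀ z : Z, ProjLE (p z) (z * f)) → (∀ z : Z, ProjLE (q z) (z * f)) →
      (∀ z, p z * q z = 0) → ∀ z w, p z * q w = 0 := fun {p q} hq lp lq h z w => by
    by_cases hzw : z = w
    · rw [hzw, h]
    · exact ortho hq lp lq z w hzw
  obtain ⟨a', ja⟩ := exists_isJoin a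
  obtain ⟨b', jb⟩ := exists_isJoin b
  obtain ⟨c', jc⟩ := exists_isJoin c
  have oab := ortho' pb la lb hab
  have oac := ortho' pc la lc hac
  have obc := ortho' pc lb lc hbc
  have oabc := ortho' pc lab lc habc
  have jab := ja.add jb pa pb oab
  have jabc := jab.add jc pab pc oabc
  simp only [sum] at jabc
  have hsum : a' + b' + c' = f := jabc.eq hj
  have hab' : a' * b' = 0 := ja.mul_eq_zero fun i => jb.mul_eq_zero' pb (oab i)
  have hbc' : b' * c' = 0 := jb.mul_eq_zero fun i => jc.mul_eq_zero' pc (obc i)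
  have habc' : (a' + b') * c' = 0 := jab.mul_eq_zero fun i => jc.mul_eq_zero' pc (oabc i)
  have eab : ProjEquiv a' b' := ja.projEquiv jb pa (ortho pa la la) (ortho pb lb lb) oab
    fun z => (T z).equiv.1
  have eac : ProjEquiv a' c' := ja.projEquiv jc pa (ortho pa la la) (ortho pc lc lc) oac
    fun z => (T z).equiv.2.1
  have eabc : ProjEquiv (a' + b') c' := jab.projEquiv jc pab (ortho pab lab lab) (ortho pc lc lc)
    oabc fun z => (T z).equiv.2.2
  have ecb : ProjEquiv c' b' := eac.symm.trans eab jc.1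
  have hcb' := IsStarProjection.orthogonal_symm jb.1 jc.1 hbc'
  have hs := jab.1
  -- `f` is not orthogonal to its parts, so `f ∼ c'` cannot be glued directly. It follows from the
  -- glued relations: `f = (a' + b') + c' ∼ c' + b' ∼ a' + b' ∼ c'`.
  have e1 : ProjEquiv f (c' + b') := by
    rw [← hsum]; exact ProjEquiv.add hs jc.1 habc' hcb' eabc ecb
  have e2 : ProjEquiv (c' + b') (a' + b') :=
    ProjEquiv.add jc.1 jb.1 hcb' hab' eac.symm (ProjEquiv.refl jb.1)
  have e3 : ProjEquiv f c' := (e1.trans e2 hf).trans eabc hf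
  have ls : ProjLE (a' + b') f := by rw [← hsum]; exact projLE_add_left hs habc'
  exact ⟨a', b', ja.1, jb.1, hab', (projLE_add_left ja.1 hab').trans ls,
    (projLE_add_right jb.1 (IsStarProjection.orthogonal_symm ja.1 jb.1 hab')).trans ls,
    eac.trans e3.symm ja.1, ecb.symm.trans e3.symm jb.1⟩

/-- Since `b` misses the copy `a` of `e`, iterating `e ∼ a` on `b` produces a sequence of orthogonal
copies of `e`; `dim` strictly exceeds its cardinality. -/
theorem aleph0_lt_dim {e a b : A} (he : IsStarProjection e) (he0 : e ≠ 0)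
    (hb : IsStarProjection b) (hab : a * b = 0) (ha : IsStarProjection a) (hae : ProjLE a e)
    (hbe : ProjLE b e) (ea : ProjEquiv a e) (eb : ProjEquiv b e) : Cardinal.aleph0 < dim e := by
  obtain ⟨p, hp, hpe, hpb, hpo⟩ := exists_orthogonal_sequence he ea.symm hae hb hbe
    (IsStarProjection.orthogonal_symm ha hb hab)
  refine lt_dim he0 ?_
  have := mk_mem_decompositionCardinals (ι := ULift.{u} ℕ) (q := fun n => p n.down) he
    (fun n => hp _) (fun m n hmn => hpo _ _ fun h => hmn (ULift.down_injective h))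
    (fun n => (hpb _).trans eb (hp _)) fun n => hpe _
  rwa [Cardinal.mk_uLift, Cardinal.mk_nat, Cardinal.lift_aleph0] at this

/-- A sum of fewer than `dim E` copies of `E`, with a remainder dominated by `E`, is dominated
by `E`. -/
theorem IsCopyDecomposition.projSub_of_lt_dim {ι : Type u} [Nonempty ι] {p : ι → A} {r E F a b : A}
    (D : IsCopyDecomposition p r E F) (hE : IsStarProjection E) (hE0 : E ≠ 0)
    (ha : IsStarProjection a) (hb : IsStarProjection b) (hab : a * b = 0) (hae : ProjLE a E)
    (hbe : ProjLE b E) (ea : ProjEquiv a E) (eb : ProjEquiv b E)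
    (hlt : Cardinal.mk ι < dim E) : ProjSub F E := by
  classical
  obtain ⟨β, ⟨κ, k, hk, hke, rfl⟩, hle⟩ := exists_le_of_lt_dim hE0 hlt
  have hkj := hk.isJoin
  obtain ⟨hkp, hko, -⟩ := hk
  obtain ⟨i₀⟩ := ‹Nonempty ι›
  have hp0 := D.isStarProjection i₀
  -- Transport the decomposition of `E` into the single copy `p i₀`, so that the rest of `F` is
  -- compared with something orthogonal to it.
  obtain ⟨v, hv1, hv2⟩ := (D.equiv i₀).symm
  have hkv : ∀ j, ProjLE (k j) (v * star v) := fun j => hv1 ▸ hkj.projLE j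
  have hvp : IsStarProjection (v * star v) := hv1 ▸ hE
  obtain ⟨X, hX⟩ := exists_isJoin (fun j => star v * k j * v)
  have hXp : ProjLE X (p i₀) := hX.projLE_of_forall fun j => hv2 ▸ conj_projLE hvp
  have hj0 : IsJoin (p ∘ fun _ : Unit => i₀) (p i₀) :=
    ⟨hp0, fun x => by simp⟩
  obtain ⟨c, hc, hca, hF, hsub⟩ := D.exists_compl hj0
  have hcp : ProjSub c X := by
    refine hsub _ X hX (fun j => isStarProjection_conj (hkp j) (hkv j)) (fun i j hij => ?_)
      (fun j => ?_) hXp ?_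
    · rw [conj_mul_conj (hkv i), hko i j hij, mul_zero, zero_mul]
    · exact (projEquiv_conj (hkp j) (hkv j)).symm.trans (hke j)
        (isStarProjection_conj (hkp j) (hkv j))
    -- The remainder takes the vacated place of `i₀`, so exactly `|ι|` targets are needed, whether
    -- `ι` is finite or not.
    · rw [← Cardinal.le_def]
      refine le_trans (le_of_eq (Cardinal.mk_congr ?_)) hle
      refine (Equiv.optionCongr (Equiv.subtypeEquivRight fun i => ?_)).trans
        (Equiv.optionSubtypeNe i₀)
      simp [eq_comm]
  have hpE : ProjSub (p i₀) E := (D.equiv i₀).projSub hp0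
  rw [hF]
  exact projSub_add_of_halving ha hb hE hab hae hbe ea eb hc hp0 hca
    ((hcp.trans (hXp.projSub hX.1) hc hX.1).trans hpE hc hp0) hpE

theorem mul_eq_zero_of_centralCover_eq {e f w : A} (hw : IsCentralProjection w)
    (h : centralCover e = centralCover f) (he : w * e = 0) : w * f = 0 := by
  have h1 : ProjLE e (1 - w) := by
    unfold ProjLE
    rw [mul_sub, mul_one, hw.comm, he, sub_zero]
  have h2 := (isCentralCover_centralCover e).2.2 _ hw.one_sub h1
  rw [h] at h2
  have h3 := ((isCentralCover_centralCover f).2.1.trans h2).mul_eq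
  rwa [mul_sub, mul_one, sub_eq_self, hw.comm] at h3

/-- Replacing `w` by `w * centralCover e` changes nothing on `e` and brings it below the central
cover. -/
theorem IsEquidimensional.dim_central_mul {e w : A} (he : IsEquidimensional e)
    (hw : IsCentralProjection w) (h0 : w * e ≠ 0) : dim (w * e) = dim e := by
  have hC := isCentralCover_centralCover e
  have hCe : centralCover e * e = e := by rw [← hC.1.comm, hC.2.1.mul_eq]
  have h1 : w * centralCover e * e = w * e := by rw [mul_assoc, hCe]
  have he0 : e ≠ 0 := fun h => h0 (by rw [h, mul_zero])
  rw [← h1]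
  refine (he.resolve_left he0).2 _ (hw.mul hC.1) (fun h => h0 ?_) (mul_projLE_right _ hC.1.1)
  rw [← h1, h, zero_mul]

end Exhaustion

end AWStar

/-! ### The theorem. -/

open AWStar in
theorem theorem5p3 {A : Type u} [CStarAlgebra A] [AWStar.IsAWStarAlgebra A] (e f : A)
    (he : AWStar.IsProperlyInfinite e) (hf : AWStar.IsProperlyInfinite f)
    (hed : AWStar.IsEquidimensional e) (hfd : AWStar.IsEquidimensional f)
    (hcover : AWStar.centralCover e = AWStar.centralCover f)
    (hlt : AWStar.ProjStrictSub e f) :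
    AWStar.dim e < AWStar.dim f := by
  obtain ⟨hef, hne⟩ := hlt.resolve_right fun h => he.2.1 h.1
  by_contra hdim
  rw [not_lt] at hdim
  apply hne
  obtain ⟨a, b, ha, hb, hab, hae, hbe, ea, eb⟩ := he.exists_halving
  obtain ⟨a', b', ha', hb', hab', haf, hbf, ea', eb'⟩ := hf.exists_halving
  have pe := he.1
  have pf := hf.1
  obtain ⟨e', pe', hee', he'f⟩ := hef
  obtain ⟨Z, hZ, hZo, hj⟩ := exists_central_partition pf
      (P := fun z => ProjEquiv (z * e) (z * f)) fun y hy hy0 => by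
    have hye : y * e ≠ 0 := fun h => hy0 (mul_eq_zero_of_centralCover_eq hy hcover h)
    have hye' : y * e' ≠ 0 := fun h =>
      hye ((h ▸ hee'.central_mul hy : ProjEquiv (y * e) 0)).eq_zero
    have ps := hy.isStarProjection_mul pe'
    have pF := hy.isStarProjection_mul pf
    -- Starting the family from the one copy `y * e'` guarantees that the index type is nonempty.
    obtain ⟨z, hz, hz0, ι, p, r, hcard, D⟩ := exists_isCopyDecomposition pF ps hye'
      (M₀ := {y * e'}) (Set.singleton_nonempty _)
      (by rintro _ rfl; exact ⟨ps, he'f.central_mul hy, ProjEquiv.refl ps⟩) (by simp)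
    have hw := hz.mul hy
    rw [← mul_assoc] at hz0
    rw [← mul_assoc, ← mul_assoc] at D
    have : Nonempty ι := by
      rw [← Cardinal.mk_ne_zero_iff]
      rw [Cardinal.mk_singleton] at hcard
      exact (zero_lt_one.trans_le hcard).ne'
    have hwee' := hee'.central_mul hw
    have hwe : z * y * e ≠ 0 := fun h => hz0 ((h ▸ hwee'.symm : ProjEquiv (z * y * e') 0)).eq_zero
    have hwf : z * y * f ≠ 0 := fun h => hwe (mul_eq_zero_of_centralCover_eq hw hcover.symm h)
    have pE := hw.isStarProjection_mul pe
    have pE' := hw.isStarProjection_mul pe'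
    have DE : IsCopyDecomposition p r (z * y * e) (z * y * f) :=
      { D with
        equiv := fun i => (D.equiv i).trans hwee'.symm (D.isStarProjection i)
        rest_sub := D.rest_sub.trans (hwee'.symm.projSub pE') D.rest pE' }
    refine ⟨z, hz, hwf, ?_⟩
    have hwa := hw.isStarProjection_mul ha
    have hwb := hw.isStarProjection_mul hb
    have hwab : z * y * a * (z * y * b) = 0 := by rw [hw.mul_mul_mul, hab, mul_zero]
    rcases lt_or_ge (Cardinal.mk ι) (dim (z * y * e)) with hι | hι
    · refine ProjSub.antisymm pE D.isJoin.1 ⟨_, pE', hwee', he'f.central_mul hw⟩ ?_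
      exact DE.projSub_of_lt_dim pE hwe hwa hwb hwab (hae.central_mul hw) (hbe.central_mul hw)
        (ea.central_mul hw) (eb.central_mul hw) hι
    · exfalso
      have : Infinite ι := Cardinal.infinite_iff.mpr ((aleph0_lt_dim pE hwe hwb hwab hwa
        (hae.central_mul hw) (hbe.central_mul hw) (ea.central_mul hw)
        (eb.central_mul hw)).le.trans hι)
      obtain ⟨k, hk, hko, hke, hkF⟩ := D.exists_copies
      have hlt := lt_dim hwf (mk_mem_decompositionCardinals D.isJoin.1 hk hko hke hkF)
      rw [hfd.dim_central_mul hw hwf] at hlt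
      rw [hed.dim_central_mul hw hwe] at hι
      exact (hlt.trans_le (hdim.trans hι)).false
  -- Move `e` below the half `a'` of `f`: the pieces of `e₁` and of the other half `b'` are mutually
  -- orthogonal, as gluing requires.
  obtain ⟨e₁, pe₁, hee₁, he₁a⟩ := ProjSub.trans ⟨e', pe', hee', he'f⟩ (ea'.symm.projSub pf) pe pf
  have he₁f := he₁a.trans haf
  have join : ∀ {g : A}, IsStarProjection g → ProjLE g f → IsJoin (fun z : Z => (z : A) * g) g := by
    intro g hg hgf
    refine ⟨hg, fun x => ⟨fun hx z => by rw [mul_assoc, hx, mul_zero], fun hx => ?_⟩⟩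
    rw [← hgf.mul_eq' hg pf, mul_assoc]
    refine hj.mul_eq_zero fun z => ?_
    rw [mul_assoc, ← mul_assoc f, hgf.mul_eq' hg pf, ← mul_assoc, hx]
  have hortho : e₁ * b' = 0 :=
    mul_eq_zero_of_projLE he₁a hb' hb' (ProjLE.refl hb') hab'
  have hcross : ∀ z w : Z, ∀ g h : A, g * h = 0 ∨ z ≠ w → (z : A) * g * (w * h) = 0 := by
    intro z w g h hgh
    rw [mul_assoc, ← mul_assoc g, (hZ w w.2).1.comm g, mul_assoc (w : A), ← mul_assoc (z : A)]
    rcases hgh with hgh | hzw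
    · rw [hgh, mul_zero]
    · rw [hZo z.2 w.2 (Subtype.coe_injective.ne hzw), zero_mul]
  have key : ProjEquiv e₁ b' := by
    refine (join pe₁ he₁f).projEquiv (join hb' hbf)
      (fun z => (hZ z z.2).1.isStarProjection_mul pe₁)
      (fun z w hzw => hcross z w _ _ (.inr hzw)) (fun z w hzw => hcross z w _ _ (.inr hzw))
      (fun z w => hcross z w _ _ (.inl hortho)) fun z => ?_
    have hz := (hZ z z.2).1
    exact ((hee₁.symm.central_mul hz).trans (hZ z z.2).2 (hz.isStarProjection_mul pe₁)).trans
      (eb'.symm.central_mul hz) (hz.isStarProjection_mul pe₁)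
  exact (hee₁.trans key pe).trans eb' pe
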